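/- Fix $\lambda\in i\mathbb R$. Let $W_\lambda$ be the space of smooth even homogeneous functions of degree $\lambda-1$ on $\mathbb R^2\smallsetminus\{0\}$, with $f(cv)=|c|^{\lambda-1}f(v)$ for $c\in\mathbb R\smallsetminus\{0\}$. Let $\mathrm{GL}_2(\mathbb R)$ act on functions on the plane by $\pi_\lambda(g)f(v)=|\det g|^{(\lambda-1)/2}f(g^{-1}v)$ and put $\langle f,h\rangle=\pi^{-1}\int_{\mathbb R}f(t,1)\overline{h(t,1)}\,dt$; on $W_\lambda$ this is the unitary principal series representation of $\mathrm{PGL}_2(\mathbb R)$. For $n\in\mathbb Z$ let $e_n(x,y)=\left(\frac{y+ix}{\sqrt{x^2+y^2}}\right)^{n}(x^2+y^2)^{(\lambda-1)/2}$ be the normalized vector of $K$-type of weight $n$, so that $e_n(x,1)=e^{in\arctan x}(1+x^2)^{(\lambda-1)/2}$ (it lies in $W_\lambda$ when $n$ is even), and let $[a]=\mathrm{diag}(a^{-1},a)$ for $a>0$. Then there are constants $C>0$ and $M$, depending only on $\lambda$, such that the following holds. Let $a\ge 1$ be real and let $m,n>0$ be integers. Put $\beta=(n/m)^{1/2}$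 and $\varepsilon=a/\beta-1$. Suppose that $\beta\ge 2$, that $n/\beta^2\ge M$, and that the Airy condition $$0\le\varepsilon\le (n/\beta^2)^{-2/3}\le \tfrac12$$ is satisfied. Then $$|\langle\pi_\lambda([a])e_m,e_n\rangle|^2\ \ge\ C\, n^{-2/3}\beta^{-2/3}.$$ -/

import Mathlib

open scoped ContDiff

noncomputable section

namespace PrincipalSeries

/-- The action `π_λ` of `GL₂(ℝ)` on functions on the plane,
`(π_λ(g) f)(v) = |det g|^((λ-1)/2) f(g⁻¹ v)`, with `v` a column vector. -/
def action (l : ℂ) : Representation ℂ (GL (Fin 2) ℝ) ((Fin 2 → ℝ) → ℂ) where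
  toFun g :=
    { toFun := fun f v =>
        ((|(g : Matrix (Fin 2) (Fin 2) ℝ).det| : ℝ) : ℂ) ^ ((l - 1) / 2) *
          f (((g⁻¹ : GL (Fin 2) ℝ) : Matrix (Fin 2) (Fin 2) ℝ).mulVec v)
      map_add' := fun f h => by ext v; simp [mul_add]
      map_smul' := fun c f => by ext v; simp [mul_left_comm] }
  map_one' := by ext f v; simp
  map_mul' g h := by
    ext f v
    simp only [LinearMap.coe_mk, AddHom.coe_mk, Module.End.mul_apply, Units.val_mul,
      Matrix.det_mul, abs_mul, mul_inv_rev, Complex.ofReal_mul]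
    rw [Complex.mul_cpow_ofReal_nonneg (abs_nonneg _) (abs_nonneg _), mul_assoc,
      Matrix.mulVec_mulVec]

/-- The space `W_λ` of smooth even homogeneous functions of degree `λ - 1` on `ℝ² ∖ {0}`
(functions on the punctured plane are extended by `0` to the origin). -/
def space (l : ℂ) : Submodule ℂ ((Fin 2 → ℝ) → ℂ) where
  carrier := {f | f 0 = 0 ∧ ContDiffOn ℝ ∞ f {0}ᶜ ∧
    ∀ (c : ℝ) (v : Fin 2 → ℝ), c ≠ 0 → v ≠ 0 → f (c • v) = ((|c| : ℝ) : ℂ) ^ (l - 1) * f v}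
  zero_mem' := ⟨rfl, contDiffOn_const, by simp⟩
  add_mem' := by
    rintro f h ⟨f0, fs, fh⟩ ⟨h0, hs, hh⟩
    refine ⟨by simp [f0, h0], fs.add hs, fun c v hc hv => ?_⟩
    simp [fh c v hc hv, hh c v hc hv, mul_add]
  smul_mem' := by
    rintro z f ⟨f0, fs, fh⟩
    refine ⟨by simp [f0], fs.const_smul z, fun c v hc hv => ?_⟩
    simp [fh c v hc hv, mul_left_comm]

/-- The Hermitian form in the line model, `⟨v, u⟩ = π⁻¹ ∫ v(t) conj(u(t)) dt`, where a
homogeneous function is identified with its restriction to the line `{(t, 1)}`. -/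
def form (f h : (Fin 2 → ℝ) → ℂ) : ℂ :=
  (Real.pi : ℂ)⁻¹ * ∫ t : ℝ, f ![t, 1] * (starRingEnd ℂ) (h ![t, 1])

/-- The vector `e_n` of `K`-type of weight `n`: in polar coordinates `x + i y` is replaced by
`y + i x = r e^{iθ}`, so that on the line `y = 1` one has `θ = arctan x`; then
`e_n = e^{inθ} r^{λ-1}`.  See `kType_line`. -/
def kType (l : ℂ) (n : ℤ) (v : Fin 2 → ℝ) : ℂ :=
  (((v 1 : ℂ) + v 0 * Complex.I) / (Real.sqrt (v 0 ^ 2 + v 1 ^ 2) : ℂ)) ^ n *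
    (Real.sqrt (v 0 ^ 2 + v 1 ^ 2) : ℂ) ^ (l - 1)

/-- The diagonal matrix `[a] = diag(a⁻¹, a)`. -/
def diagElt (a : ℝ) (ha : 0 < a) : GL (Fin 2) ℝ :=
  Matrix.GeneralLinearGroup.mkOfDetNeZero !![a⁻¹, 0; 0, a]
    (by simp [Matrix.det_fin_two_of, ha.ne'])

/-- The matrix coefficient `⟨π_λ([a]) e_m, e_n⟩`. -/
def matrixCoeff (l : ℂ) (a : ℝ) (ha : 0 < a) (m n : ℤ) : ℂ :=
  form (action l (diagElt a ha) (kType l m)) (kType l n)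

/-- `π_λ` preserves `W_λ`. -/
theorem action_mem_space (l : ℂ) (g : GL (Fin 2) ℝ) {f : (Fin 2 → ℝ) → ℂ}
    (hf : f ∈ space l) : action l g f ∈ space l := by
  obtain ⟨f0, fs, fh⟩ := hf
  have hne : ∀ v : Fin 2 → ℝ, v ≠ 0 →
      ((g⁻¹ : GL (Fin 2) ℝ) : Matrix (Fin 2) (Fin 2) ℝ).mulVec v ≠ 0 := by
    intro v hv h
    apply hv
    have := congrArg (fun w => (g : Matrix (Fin 2) (Fin 2) ℝ).mulVec w) h
    rwa [Matrix.mulVec_mulVec, ← Units.val_mul, mul_inv_cancel, Units.val_one, Matrix.one_mulVec,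
      Matrix.mulVec_zero] at this
  refine ⟨?_, ?_, fun c v hc hv => ?_⟩
  · simp only [action, MonoidHom.coe_mk, OneHom.coe_mk, LinearMap.coe_mk, AddHom.coe_mk,
      Matrix.mulVec_zero, f0, mul_zero]
  · refine contDiffOn_const.mul (fs.comp (t := {0}ᶜ) ?_ fun v hv => hne v hv)
    exact (LinearMap.toContinuousLinearMap
      (Matrix.mulVecLin ((g⁻¹ : GL (Fin 2) ℝ) : Matrix (Fin 2) (Fin 2) ℝ))).contDiff.contDiffOn
  · simp only [action, MonoidHom.coe_mk, OneHom.coe_mk, LinearMap.coe_mk, AddHom.coe_mk,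
      Matrix.mulVec_smul]
    rw [fh c _ hc (hne v hv), mul_left_comm]

/-- In the line model `e_n(x) = e^{i n arctan x} (1 + x²)^((λ-1)/2)`. -/
theorem kType_line (l : ℂ) (n : ℤ) (x : ℝ) :
    kType l n ![x, 1] =
      Complex.exp (Complex.I * n * Real.arctan x) * ((1 + x ^ 2 : ℝ) : ℂ) ^ ((l - 1) / 2) := by
  have hpos : 0 < 1 + x ^ 2 := by positivity
  have hs : 0 < Real.sqrt (1 + x ^ 2) := Real.sqrt_pos.2 hpos
  have h1 : ((1 : ℂ) + x * Complex.I) / (Real.sqrt (1 + x ^ 2) : ℂ) =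
      Complex.exp (Real.arctan x * Complex.I) := by
    rw [Complex.exp_mul_I, ← Complex.ofReal_cos, ← Complex.ofReal_sin, Real.cos_arctan,
      Real.sin_arctan]
    push_cast
    ring
  have h2 : (Real.sqrt (1 + x ^ 2) : ℂ) ^ (l - 1) =
      ((1 + x ^ 2 : ℝ) : ℂ) ^ ((l - 1) / 2) := by
    rw [Complex.cpow_def_of_ne_zero (by exact_mod_cast hs.ne'),
      Complex.cpow_def_of_ne_zero (by exact_mod_cast hpos.ne'), ← Complex.ofReal_log hs.le,
      ← Complex.ofReal_log hpos.le, Real.log_sqrt hpos.le]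
    congr 1
    push_cast
    ring
  simp only [kType, Matrix.cons_val_zero, Matrix.cons_val_one, Complex.ofReal_one,
    one_pow, add_comm (x ^ 2) 1]
  rw [h1, h2, ← Complex.exp_int_mul]
  congr 2
  ring

/-- For even `n` (the weights of `K`-types of `PGL₂(ℝ)`) the vector `e_n` lies in `W_λ`. -/
theorem kType_mem_space (l : ℂ) (hl : l ≠ 1) (n : ℤ) (hn : Even n) :
    kType l n ∈ space l := by
  have hpos : ∀ v : Fin 2 → ℝ, v ≠ 0 → 0 < v 0 ^ 2 + v 1 ^ 2 := by
    intro v hv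
    by_contra h
    apply hv
    ext i
    fin_cases i <;> simp <;> nlinarith [sq_nonneg (v 0), sq_nonneg (v 1)]
  refine ⟨by simp [kType, sub_ne_zero.2 hl], ?_, fun c v hc hv => ?_⟩
  · intro v hv
    have hp := hpos v hv
    have hs : 0 < Real.sqrt (v 0 ^ 2 + v 1 ^ 2) := Real.sqrt_pos.2 hp
    have c0 : ContDiffAt ℝ ∞ (fun w : Fin 2 → ℝ => w 0) v := by fun_prop
    have c1 : ContDiffAt ℝ ∞ (fun w : Fin 2 → ℝ => w 1) v := by fun_prop
    have cs : ContDiffAt ℝ ∞ (fun w : Fin 2 → ℝ => Real.sqrt (w 0 ^ 2 + w 1 ^ 2)) v :=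
      ((c0.pow 2).add (c1.pow 2)).sqrt hp.ne'
    have ofR : ∀ {h : (Fin 2 → ℝ) → ℝ}, ContDiffAt ℝ ∞ h v →
        ContDiffAt ℝ ∞ (fun w => (h w : ℂ)) v := fun hh =>
      Complex.ofRealCLM.contDiff.contDiffAt.comp v hh
    have cr : ContDiffAt ℝ ∞ (fun w : Fin 2 → ℝ =>
        ((Real.sqrt (w 0 ^ 2 + w 1 ^ 2) : ℝ) : ℂ) ^ (l - 1)) v := by
      have hexp : ContDiffAt ℝ ∞ (fun w : Fin 2 → ℝ =>
          Complex.exp (((Real.log (Real.sqrt (w 0 ^ 2 + w 1 ^ 2)) : ℝ) : ℂ) * (l - 1))) v :=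
        ((ofR (cs.log hs.ne')).mul contDiffAt_const).cexp
      refine hexp.congr_of_eventuallyEq ?_
      filter_upwards [isOpen_compl_singleton.mem_nhds hv] with w hw
      have hw' : 0 < Real.sqrt (w 0 ^ 2 + w 1 ^ 2) := Real.sqrt_pos.2 (hpos w hw)
      rw [Complex.cpow_def_of_ne_zero (by exact_mod_cast hw'.ne'), Complex.ofReal_log hw'.le]
    have cb : ContDiffAt ℝ ∞ (fun w : Fin 2 → ℝ =>
        ((w 1 : ℂ) + w 0 * Complex.I) * ((Real.sqrt (w 0 ^ 2 + w 1 ^ 2) : ℝ) : ℂ)⁻¹) v :=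
      ((ofR c1).add ((ofR c0).mul contDiffAt_const)).mul
        ((ofR cs).inv (by exact_mod_cast hs.ne'))
    have hb : ((v 1 : ℂ) + v 0 * Complex.I) *
        ((Real.sqrt (v 0 ^ 2 + v 1 ^ 2) : ℝ) : ℂ)⁻¹ ≠ 0 := by
      refine mul_ne_zero (fun h => ?_) (inv_ne_zero (by exact_mod_cast hs.ne'))
      have hre := congrArg Complex.re h
      have him := congrArg Complex.im h
      simp at hre him
      simp [hre, him] at hp
    refine ContDiffAt.contDiffWithinAt (ContDiffAt.mul ?_ cr)
    obtain ⟨k, rfl | rfl⟩ := n.eq_nat_or_neg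
    · simpa only [zpow_natCast, div_eq_mul_inv] using cb.pow k
    · simp only [zpow_neg, zpow_natCast, div_eq_mul_inv]
      exact (cb.pow k).inv (pow_ne_zero k hb)
  · have hs : (Real.sqrt ((c * v 0) ^ 2 + (c * v 1) ^ 2)) =
        |c| * Real.sqrt (v 0 ^ 2 + v 1 ^ 2) := by
      rw [← Real.sqrt_sq_eq_abs, ← Real.sqrt_mul (sq_nonneg c)]
      ring_nf
    simp only [kType, Pi.smul_apply, smul_eq_mul, hs]
    rw [Complex.ofReal_mul |c|, Complex.mul_cpow_ofReal_nonneg (abs_nonneg _) (Real.sqrt_nonneg _)]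
    have hz : (((c * v 1 : ℝ) : ℂ) + ((c * v 0 : ℝ) : ℂ) * Complex.I) /
        (((|c| : ℝ) : ℂ) * ((Real.sqrt (v 0 ^ 2 + v 1 ^ 2) : ℝ) : ℂ)) =
        ((c : ℂ) / ((|c| : ℝ) : ℂ)) * (((v 1 : ℂ) + v 0 * Complex.I) /
          ((Real.sqrt (v 0 ^ 2 + v 1 ^ 2) : ℝ) : ℂ)) := by
      rw [div_mul_div_comm]
      push_cast
      ring
    have hc1 : ((c : ℂ) / ((|c| : ℝ) : ℂ)) ^ n = 1 := by
      have hcc : (c : ℂ) ≠ 0 := by exact_mod_cast hc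
      rcases abs_choice c with h | h <;> rw [h]
      · rw [div_self hcc, one_zpow]
      · rw [Complex.ofReal_neg, div_neg, div_self hcc, hn.neg_one_zpow]
    rw [hz, mul_zpow, hc1]
    ring

/-- For `λ ∈ iℝ` the vectors `e_n` have norm one. -/
theorem form_kType_self (l : ℂ) (hl : l.re = 0) (n : ℤ) :
    form (kType l n) (kType l n) = 1 := by
  have h : ∀ t : ℝ, kType l n ![t, 1] * (starRingEnd ℂ) (kType l n ![t, 1]) =
      (((1 + t ^ 2)⁻¹ : ℝ) : ℂ) := by
    intro t
    have hpos : 0 < 1 + t ^ 2 := by positivity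
    rw [Complex.mul_conj, Complex.normSq_eq_norm_sq, kType_line, norm_mul, Complex.norm_exp,
      Complex.norm_cpow_eq_rpow_re_of_pos hpos]
    have h0 : (Complex.I * n * Real.arctan t).re = 0 := by
      simp [Complex.mul_re, -Complex.ofReal_arctan]
    have h1 : ((l - 1) / 2).re = -(1 / 2) := by
      simp [hl]
      norm_num
    rw [h0, h1, Real.exp_zero, one_mul, ← Real.rpow_natCast, ← Real.rpow_mul hpos.le]
    norm_num [Real.rpow_neg_one]
  simp only [form, h]
  rw [integral_complex_ofReal, integral_univ_inv_one_add_sq]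
  exact inv_mul_cancel₀ (by exact_mod_cast Real.pi_ne_zero)

end PrincipalSeries

end

/-! In the line model, the substitution t = h y / a² turns the modulus of the matrix coefficient
into π⁻¹ (h/a) |∫ e^{iΦ(y)} A(y) dy|, with Φ(y) = m arctan(h y) - n arctan(h y / a²) and an
amplitude A of modulus at most 1 (`norm_matrixCoeff_eq`). Over the common denominator, Φ' = (s -
y²)/`den` exactly, once h is normalized so that the y² coefficient is -1 (`hasDerivAt_arctanPhase`).
Then h has size m^(-1/3) and s = m h (1 - β²/a²). Since n/β² = m, the Airy condition says precisely
that s stays bounded: 0 ≤ s ≤ 2.1.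

As m grows, h tends to 0, the phase tends to s y - y³/3 and the amplitude to 1, so the integral
approaches 2 ∫₀^∞ cos(s y - y³/3) dy = 2π Ai(-s). The first zero of Ai is near -2.338, outside the
range of -s, so this limit is bounded away from 0. With h/a of size m^(-1/3)/β, the square has the
required order n^(-2/3) β^(-2/3).

Two estimates carry the argument. `exists_le_omega_mul_rayIntegral_re` proves the nonvanishing of
Ai: on the ray of argument -π/6 the integral becomes absolutely convergent, and its power series in
s is alternating after grouping. `exists_le_norm_integral` makes the limit uniform in h, b, s:
integration by parts controls |y| ≥ Y, and a direct comparison with the cubic phase handles |y| ≤ Y.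
-/

namespace AiryLowerBound

section Analysis

open MeasureTheory Set Filter Topology PrincipalSeries

/-! ### Moments of the cubic exponential and Gamma bounds -/

/-- The moments `∫₀^∞ ρ^k e^{-ρ³/3} dρ`. -/
noncomputable def cubicMoment (k : ℕ) : ℝ := ∫ ρ in Ioi (0 : ℝ), ρ ^ k * Real.exp (-(ρ ^ 3 / 3))

theorem cubicMoment_eq_Gamma (k : ℕ) :
    cubicMoment k = (1 / 3 : ℝ) ^ (-((k : ℝ) + 1) / 3) * (1 / 3) * Real.Gamma (((k : ℝ) + 1) / 3) := by
  rw [← integral_rpow_mul_exp_neg_mul_rpow (p := 3) (q := k) (b := 1 / 3) (by norm_num)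
    (by have : (0 : ℝ) ≤ k := k.cast_nonneg
        linarith) (by norm_num)]
  refine setIntegral_congr_fun measurableSet_Ioi fun ρ _ => ?_
  have : (ρ : ℝ) ^ (3 : ℝ) = ρ ^ 3 := by exact_mod_cast Real.rpow_natCast ρ 3
  simp only [Real.rpow_natCast, this]
  ring_nf

/-- This is the functional equation of Γ. It gives the ratio of power series terms three apart, so
only the moments 0 and 1 need numerical bounds. -/
theorem cubicMoment_add_three (k : ℕ) : cubicMoment (k + 3) = (k + 1) * cubicMoment k := by
  rw [cubicMoment_eq_Gamma, cubicMoment_eq_Gamma]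
  have hk : (0 : ℝ) < (k + 1) / 3 := by positivity
  have h1 : (((k + 3 : ℕ) : ℝ) + 1) / 3 = (k + 1) / 3 + 1 := by push_cast; ring
  have h2 : -(((k + 3 : ℕ) : ℝ) + 1) / 3 = -((k : ℝ) + 1) / 3 - 1 := by push_cast; ring
  rw [h1, h2, Real.Gamma_add_one hk.ne', Real.rpow_sub_one (by norm_num)]
  ring

theorem three_rpow_third_le : (3 : ℝ) ^ (1 / 3 : ℝ) ≤ 3 / 2 := by
  have h : (3 : ℝ) ^ (1 / 3 : ℝ) ≤ (27 / 8 : ℝ) ^ (1 / 3 : ℝ) :=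
    Real.rpow_le_rpow (by norm_num) (by norm_num) (by norm_num)
  have h' : (27 / 8 : ℝ) ^ (1 / 3 : ℝ) = 3 / 2 := by
    rw [show (27 / 8 : ℝ) = (3 / 2 : ℝ) ^ (3 : ℝ) by norm_num, ← Real.rpow_mul (by norm_num)]
    norm_num
  linarith

/-- Convexity of Γ between 1 and 2, where it takes the value 1. -/
theorem Gamma_four_thirds_le_one : Real.Gamma (4 / 3) ≤ 1 := by
  have h := Real.convexOn_Gamma.2 (mem_Ioi.2 one_pos) (mem_Ioi.2 two_pos)
    (show (0 : ℝ) ≤ 2 / 3 by norm_num) (show (0 : ℝ) ≤ 1 / 3 by norm_num) (by norm_num)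
  norm_num [Real.Gamma_two] at h
  exact h

/-- Midpoint convexity: 1 = Γ(1) is at most the mean of Γ(2/3) and Γ(4/3). -/
theorem one_le_Gamma_two_thirds : 1 ≤ Real.Gamma (2 / 3) := by
  have h := Real.convexOn_Gamma.2 (mem_Ioi.2 (show (0 : ℝ) < 2 / 3 by norm_num))
    (mem_Ioi.2 (show (0 : ℝ) < 4 / 3 by norm_num))
    (show (0 : ℝ) ≤ 1 / 2 by norm_num) (show (0 : ℝ) ≤ 1 / 2 by norm_num) (by norm_num)
  norm_num at h
  linarith [Gamma_four_thirds_le_one]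

theorem cubicMoment_zero_pos : 0 < cubicMoment 0 := by
  rw [cubicMoment_eq_Gamma]
  have := Real.Gamma_pos_of_pos (s := (((0 : ℕ) : ℝ) + 1) / 3) (by norm_num)
  positivity

theorem cubicMoment_zero_le : cubicMoment 0 ≤ 3 / 2 := by
  have h : Real.Gamma (4 / 3) = 1 / 3 * Real.Gamma (1 / 3) := by
    rw [← Real.Gamma_add_one (by norm_num)]
    norm_num
  have h3 : (1 / 3 : ℝ) ^ (-1 / 3 : ℝ) = 3 ^ (1 / 3 : ℝ) := by
    rw [one_div, Real.inv_rpow (by norm_num), ← Real.rpow_neg (by norm_num)]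
    norm_num
  rw [cubicMoment_eq_Gamma]
  simp only [Nat.cast_zero, zero_add]
  rw [mul_assoc, ← h, h3]
  have h0 : (0 : ℝ) ≤ (3 : ℝ) ^ (1 / 3 : ℝ) := by positivity
  nlinarith [three_rpow_third_le, Gamma_four_thirds_le_one]

theorem le_cubicMoment_one : 2 / 3 ≤ cubicMoment 1 := by
  have h3 : (1 / 3 : ℝ) ^ (-2 / 3 : ℝ) * (1 / 3) = (3 ^ (1 / 3 : ℝ))⁻¹ := by
    rw [← Real.rpow_add_one (by norm_num), one_div, Real.inv_rpow (by norm_num)]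
    norm_num
  rw [cubicMoment_eq_Gamma]
  norm_num only [Nat.cast_one]
  have h4 := h3
  norm_num only at h4
  rw [h4]
  have h0 : (0 : ℝ) < (3 : ℝ) ^ (1 / 3 : ℝ) := by positivity
  have h5 : (2 / 3 : ℝ) ≤ (3 ^ (1 / 3 : ℝ))⁻¹ := by
    rw [le_inv_comm₀ (by norm_num) h0]
    linarith [three_rpow_third_le]
  nlinarith [one_le_Gamma_two_thirds]

/-! ### Power series of the Airy integral on the rotated ray, and its nonvanishing -/

/-- `e^{iπ/3}`. -/
noncomputable def zeta : ℂ := ⟨1 / 2, Real.sqrt 3 / 2⟩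

/-- `e^{-iπ/6}`. -/
noncomputable def omega : ℂ := ⟨Real.sqrt 3 / 2, -(1 / 2)⟩

theorem sqrt_three_mul_self : Real.sqrt 3 * Real.sqrt 3 = 3 := Real.mul_self_sqrt (by norm_num)

theorem sqrt_three_pow_three : Real.sqrt 3 ^ 3 = 3 * Real.sqrt 3 := by
  rw [pow_succ, pow_two, sqrt_three_mul_self]

theorem zeta_pow_three : zeta ^ 3 = -1 := by
  apply Complex.ext <;> simp [zeta, pow_succ] <;>
    linarith [sqrt_three_mul_self, sqrt_three_pow_three]

theorem norm_zeta : ‖zeta‖ = 1 := by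
  have h : ‖zeta‖ ^ 3 = 1 := by rw [← norm_pow, zeta_pow_three, norm_neg, norm_one]
  exact (pow_eq_one_iff_of_nonneg (norm_nonneg _) (by norm_num)).1 h

theorem I_mul_omega : Complex.I * omega = zeta := by
  apply Complex.ext <;> simp [zeta, omega]

theorem omega_pow_three : omega ^ 3 = -Complex.I := by
  apply Complex.ext <;> simp [omega, pow_succ] <;>
    linarith [sqrt_three_mul_self, sqrt_three_pow_three]

theorem norm_omega : ‖omega‖ = 1 := by
  have h := congrArg norm I_mul_omega
  rwa [norm_mul, Complex.norm_I, one_mul, norm_zeta] at h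

/-- The argument of ωζᵏ is -π/6 + kπ/3, so the cosines for k = 0, 1, 2 are √3/2, √3/2, 0, and ζ³ =
-1 flips the sign at each further block. Hence every third term drops out and the blocks alternate.
-/
theorem omega_mul_zeta_pow_re (j : ℕ) :
    (omega * zeta ^ (3 * j)).re = (-1) ^ j * (Real.sqrt 3 / 2) ∧
    (omega * zeta ^ (3 * j + 1)).re = (-1) ^ j * (Real.sqrt 3 / 2) ∧
    (omega * zeta ^ (3 * j + 2)).re = 0 := by
  have h : zeta ^ (3 * j) = (((-1) ^ j : ℝ) : ℂ) := by
    rw [pow_mul, zeta_pow_three]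
    push_cast
    rfl
  have hm : ∀ (r : ℝ) (z : ℂ), (omega * ((r : ℂ) * z)).re = r * (omega * z).re := by
    intro r z
    rw [mul_left_comm, Complex.re_ofReal_mul]
  refine ⟨?_, ?_, ?_⟩
  · rw [h, mul_comm, Complex.re_ofReal_mul]; rfl
  · rw [pow_add, h, hm, pow_one]
    congr 1
    simp [omega, zeta]; ring
  · rw [pow_add, h, hm]
    refine mul_eq_zero_of_right _ ?_
    simp [omega, zeta, pow_two]
    linarith [sqrt_three_mul_self, sqrt_three_pow_three]

/-- The integral `∫₀^∞ exp(-ρ³/3 + s e^{iπ/3} ρ) dρ`. -/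
noncomputable def rayIntegral (s : ℝ) : ℂ :=
  ∫ ρ in Ioi (0 : ℝ), Complex.exp (-((ρ : ℂ) ^ 3 / 3) + s * zeta * ρ)

theorem exp_cubic_le {s ρ : ℝ} (hs : s ≤ 3) (hρ : 0 ≤ ρ) :
    Real.exp (-(ρ ^ 3 / 3) + s * ρ) ≤ Real.exp (16 / 3) * Real.exp (-ρ) := by
  rw [← Real.exp_add]
  apply Real.exp_le_exp.2
  -- ρ³/3 lies above its tangent at 2: ρ³/3 - 4ρ + 16/3 = (ρ - 2)²(ρ + 4)/3.
  nlinarith [mul_nonneg (sq_nonneg (ρ - 2)) (by linarith : 0 ≤ ρ + 4), mul_nonneg (sub_nonneg.2 hs) hρ]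

theorem integrableOn_exp_cubic {s : ℝ} (hs : s ≤ 3) :
    IntegrableOn (fun ρ : ℝ => Real.exp (-(ρ ^ 3 / 3) + s * ρ)) (Ioi 0) := by
  refine Integrable.mono' ((integrableOn_exp_neg_Ioi 0).const_mul (Real.exp (16 / 3)))
    (by fun_prop) ?_
  filter_upwards [ae_restrict_mem measurableSet_Ioi] with ρ hρ
  rw [Real.norm_of_nonneg (Real.exp_pos _).le]
  exact exp_cubic_le hs (le_of_lt hρ)

/-- Expand exp(sζρ) under the integral. As |ζ| = 1, the termwise norms sum to exp(-ρ³/3 + sρ), which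
is integrable. -/
theorem hasSum_rayIntegral {s : ℝ} (hs0 : 0 ≤ s) (hs : s ≤ 3) :
    HasSum (fun k : ℕ => ((s ^ k / k.factorial * cubicMoment k : ℝ) : ℂ) * zeta ^ k)
      (rayIntegral s) := by
  have key := hasSum_integral_of_dominated_convergence (μ := volume.restrict (Ioi (0 : ℝ)))
    (F := fun (k : ℕ) (ρ : ℝ) =>
      Complex.exp (-((ρ : ℂ) ^ 3 / 3)) * ((s * zeta * ρ) ^ k / (k.factorial : ℂ)))
    (f := fun ρ : ℝ => Complex.exp (-((ρ : ℂ) ^ 3 / 3) + s * zeta * ρ))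
    (fun k ρ => Real.exp (-(ρ ^ 3 / 3)) * ((s * ρ) ^ k / k.factorial))
    (fun k => by fun_prop) ?_ ?_ ?_ ?_
  · suffices h : (fun k : ℕ => ((s ^ k / k.factorial * cubicMoment k : ℝ) : ℂ) * zeta ^ k) =
        fun k : ℕ => ∫ ρ in Ioi (0 : ℝ),
          Complex.exp (-((ρ : ℂ) ^ 3 / 3)) * ((s * zeta * ρ) ^ k / (k.factorial : ℂ)) by
      rw [h]
      exact key
    ext1 k
    rw [cubicMoment, ← integral_const_mul, ← integral_complex_ofReal, ← integral_mul_const]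
    refine integral_congr_ae (ae_of_all _ fun ρ => ?_)
    push_cast
    ring
  · intro k
    filter_upwards [ae_restrict_mem measurableSet_Ioi] with ρ hρ
    have hρ' : 0 ≤ ρ := le_of_lt hρ
    rw [norm_mul, Complex.norm_exp, norm_div, norm_pow, norm_mul, norm_mul, norm_zeta,
      Complex.norm_real, Complex.norm_real, Complex.norm_natCast, Real.norm_of_nonneg hs0,
      Real.norm_of_nonneg hρ', mul_one]
    refine le_of_eq ?_
    congr 2
    rw [← Complex.ofReal_re (-(ρ ^ 3 / 3))]
    push_cast
    rfl
  · refine ae_of_all _ fun ρ => ?_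
    exact (Real.summable_pow_div_factorial (s * ρ)).mul_left _
  · have : (fun ρ : ℝ => ∑' k : ℕ, Real.exp (-(ρ ^ 3 / 3)) * ((s * ρ) ^ k / k.factorial)) =
        fun ρ : ℝ => Real.exp (-(ρ ^ 3 / 3) + s * ρ) := by
      ext ρ
      rw [tsum_mul_left, Real.exp_add, Real.exp_eq_exp_ℝ, NormedSpace.exp_eq_tsum_div]
    rw [this]
    exact integrableOn_exp_cubic hs
  · refine ae_of_all _ fun ρ => ?_
    rw [Complex.exp_add]
    refine HasSum.mul_left _ ?_
    rw [Complex.exp_eq_exp_ℂ]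
    exact NormedSpace.expSeries_div_hasSum_exp _

/-- The absolute value of the `j`-th block of three terms in the power series of
`Re (e^{-iπ/6} ∫₀^∞ exp(-ρ³/3 + s e^{iπ/3} ρ) dρ)`, up to the factor `√3 / 2`. -/
noncomputable def block (s : ℝ) (j : ℕ) : ℝ :=
  s ^ (3 * j) / (3 * j).factorial * cubicMoment (3 * j) +
    s ^ (3 * j + 1) / (3 * j + 1).factorial * cubicMoment (3 * j + 1)

theorem tendsto_sum_block {s : ℝ} (hs0 : 0 ≤ s) (hs : s ≤ 3) :
    Tendsto (fun n : ℕ => ∑ j ∈ Finset.range n, (-1 : ℝ) ^ j * (Real.sqrt 3 / 2) * block s j) atTop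
      (𝓝 (omega * rayIntegral s).re) := by
  have h := Complex.hasSum_re ((hasSum_rayIntegral hs0 hs).mul_left omega)
  have h2 := h.tendsto_sum_nat.comp (tendsto_id.const_mul_atTop' (r := 3) (by norm_num))
  refine h2.congr fun n => ?_
  simp only [Function.comp_apply, id]
  induction n with
  | zero => simp
  | succ n ih =>
    obtain ⟨h0, h1, h3⟩ := omega_mul_zeta_pow_re n
    have hm : ∀ (r : ℝ) (z : ℂ), (omega * ((r : ℂ) * z)).re = r * (omega * z).re := by
      intro r z
      rw [mul_left_comm, Complex.re_ofReal_mul]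
    rw [Finset.sum_range_succ, ← ih, show 3 * (n + 1) = 3 * n + 1 + 1 + 1 by ring,
      Finset.sum_range_succ, Finset.sum_range_succ, Finset.sum_range_succ, hm, hm, hm, h0, h1, h3,
      block]
    ring

theorem pow_term_succ (s : ℝ) (k : ℕ) :
    s ^ (k + 3) / (k + 3).factorial * cubicMoment (k + 3) =
      s ^ 3 / ((k + 2) * (k + 3)) * (s ^ k / k.factorial * cubicMoment k) := by
  rw [cubicMoment_add_three, Nat.factorial_succ, Nat.factorial_succ, Nat.factorial_succ]
  have : (k.factorial : ℝ) ≠ 0 := by exact_mod_cast k.factorial_ne_zero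
  push_cast
  field_simp
  ring

theorem cubicMoment_nonneg (k : ℕ) : 0 ≤ cubicMoment k :=
  setIntegral_nonneg measurableSet_Ioi fun _ hρ =>
    mul_nonneg (pow_nonneg (le_of_lt hρ) _) (Real.exp_pos _).le

/-- The ratio of terms is s³/((k+2)(k+3)), with s³ ≤ 10 and denominator at least 30 for k ≥ 3. The
first block is excluded because s³/6 can exceed 1. -/
theorem block_succ_le {s : ℝ} (hs0 : 0 ≤ s) (hs : s ≤ 21 / 10) (j : ℕ) (hj : 1 ≤ j) :
    block s (j + 1) ≤ block s j := by
  have hs3 : s ^ 3 ≤ 10 := (pow_le_pow_left₀ hs0 hs 3).trans (by norm_num)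
  have key : ∀ k : ℕ, 3 ≤ k → s ^ (k + 3) / (k + 3).factorial * cubicMoment (k + 3) ≤
      s ^ k / k.factorial * cubicMoment k := by
    intro k hk
    rw [pow_term_succ]
    have hk' : (3 : ℝ) ≤ k := by exact_mod_cast hk
    refine mul_le_of_le_one_left (mul_nonneg (by positivity) (cubicMoment_nonneg k)) ?_
    rw [div_le_one (by positivity)]
    nlinarith
  have h0 := key (3 * j) (by omega)
  have h1 := key (3 * j + 1) (by omega)
  rw [block, block]
  exact add_le_add h0 h1

/-- Alternating series: from four blocks on, adding two more blocks contributes a nonnegative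
amount. -/
theorem sum_four_le {s : ℝ} (hs0 : 0 ≤ s) (hs : s ≤ 21 / 10) :
    Real.sqrt 3 / 2 * (block s 0 - block s 1 + block s 2 - block s 3) ≤
      (omega * rayIntegral s).re := by
  have h := (tendsto_sum_block hs0 (by linarith)).comp
    (tendsto_id.const_mul_atTop' (r := 2) (by norm_num))
  refine ge_of_tendsto h (eventually_atTop.2 ⟨2, fun n hn => ?_⟩)
  simp only [Function.comp_apply, id]
  induction n, hn using Nat.le_induction with
  | base => norm_num [Finset.sum_range_succ]; linarith
  | succ n hn ih =>
    rw [show 2 * (n + 1) = 2 * n + 1 + 1 by ring, Finset.sum_range_succ, Finset.sum_range_succ]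
    have h1 := block_succ_le hs0 hs (2 * n) (by omega)
    have h2 : (-1 : ℝ) ^ (2 * n) = 1 := by rw [pow_mul]; norm_num
    have h3 : (-1 : ℝ) ^ (2 * n + 1) = -1 := by rw [pow_succ, h2]; norm_num
    rw [h2, h3]
    nlinarith [mul_nonneg (show (0 : ℝ) ≤ Real.sqrt 3 / 2 by positivity) (sub_nonneg.2 h1)]

theorem four_blocks_eq (s : ℝ) :
    block s 0 - block s 1 + block s 2 - block s 3 =
      cubicMoment 0 * (1 - s ^ 3 / 6 + (s ^ 3) ^ 2 / 180 - (s ^ 3) ^ 3 / 12960) +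
        cubicMoment 1 * (s * (1 - s ^ 3 / 12 + (s ^ 3) ^ 2 / 504 - (s ^ 3) ^ 3 / 45360)) := by
  simp only [block, Nat.reduceMul, Nat.reduceAdd, mul_zero, mul_one, zero_add]
  rw [pow_term_succ s 6, pow_term_succ s 7, pow_term_succ s 3, pow_term_succ s 4,
    pow_term_succ s 0, pow_term_succ s 1]
  norm_num
  ring

/-- The Airy function has no zero on `[-2.1, 0]`. -/
theorem exists_le_omega_mul_rayIntegral_re :
    ∃ c : ℝ, 0 < c ∧ ∀ s : ℝ, 0 ≤ s → s ≤ 21 / 10 → c ≤ (omega * rayIntegral s).re := by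
  have hG := cubicMoment_zero_pos
  refine ⟨Real.sqrt 3 / 2 * (cubicMoment 0 * (1 / 20)), by positivity, fun s hs0 hs => ?_⟩
  refine le_trans ?_ (sum_four_le hs0 hs)
  refine mul_le_mul_of_nonneg_left ?_ (by positivity)
  rw [four_blocks_eq]
  have hG1 : 2 / 5 * cubicMoment 0 ≤ cubicMoment 1 := by
    linarith [le_cubicMoment_one, cubicMoment_zero_le]
  set w := s ^ 3 with hw
  have hw0 : 0 ≤ w := by positivity
  -- 9.261 = 2.1³.
  have hw1 : w ≤ 9.261 := (pow_le_pow_left₀ hs0 hs 3).trans (by norm_num)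
  have hq : 19 / 50 ≤ 1 - w / 12 + w ^ 2 / 504 - w ^ 3 / 45360 := by
    -- This product is q(w) - q(9.261), so q is bounded below by its value at the endpoint; p is
    -- treated the same way.
    have : 0 ≤ (9.261 - w) * (1 / 12 - (w + 9.261) / 504 + (w ^ 2 + w * 9.261 + 9.261 ^ 2) / 45360) :=
      mul_nonneg (by linarith) (by nlinarith)
    nlinarith
  have hp : -(13 / 100) ≤ 1 - w / 6 + w ^ 2 / 180 - w ^ 3 / 12960 := by
    have : 0 ≤ (9.261 - w) * (1 / 6 - (w + 9.261) / 180 + (w ^ 2 + w * 9.261 + 9.261 ^ 2) / 12960) :=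
      mul_nonneg (by linarith) (by nlinarith)
    nlinarith
  set q := 1 - w / 12 + w ^ 2 / 504 - w ^ 3 / 45360
  set p := 1 - w / 6 + w ^ 2 / 180 - w ^ 3 / 12960 with hpdef
  have hm : 1 / 20 ≤ p + 2 / 5 * (s * q) := by
    -- For small s the polynomial p alone suffices; for larger s the term (2/5) s q outweighs the
    -- possibly negative p.
    rcases le_total s (3 / 2) with h | h
    · have hw2 : w ≤ 3.375 := (pow_le_pow_left₀ hs0 h 3).trans (by norm_num)
      have : 1 / 20 ≤ p := by
        rw [hpdef]
        nlinarith [mul_nonneg hw0 (sub_nonneg.2 hw2), mul_nonneg (sq_nonneg w) (sub_nonneg.2 hw2)]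
      have : 0 ≤ s * q := by positivity
      linarith
    · nlinarith
  have hsq : 0 ≤ s * q := mul_nonneg hs0 (by linarith)
  nlinarith [mul_le_mul_of_nonneg_right hG1 hsq, mul_le_mul_of_nonneg_left hm hG.le]

/-! ### Contour rotation for the truncated Airy integral -/

/-- The entire function `exp (i (s z - z³/3))`. -/
noncomputable def airyPhase (s : ℝ) (z : ℂ) : ℂ := Complex.exp (Complex.I * (s * z - z ^ 3 / 3))

theorem airyPhase_omega_mul (s ρ : ℝ) :
    airyPhase s (omega * ρ) = Complex.exp (-((ρ : ℂ) ^ 3 / 3) + s * zeta * ρ) := by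
  rw [airyPhase, ← I_mul_omega]
  congr 1
  rw [mul_pow, omega_pow_three]
  linear_combination (-(ρ : ℂ) ^ 3 / 3 * -1) * Complex.I_mul_I

theorem norm_exp_ray (s ρ : ℝ) :
    ‖Complex.exp (-((ρ : ℂ) ^ 3 / 3) + s * zeta * ρ)‖ = Real.exp (-(ρ ^ 3 / 3) + s / 2 * ρ) := by
  rw [Complex.norm_exp]
  congr 1
  have : (-((ρ : ℂ) ^ 3 / 3) + s * zeta * ρ) =
      ((-(ρ ^ 3 / 3) : ℝ) : ℂ) + ((s * ρ : ℝ) : ℂ) * zeta := by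
    push_cast
    ring
  rw [this, Complex.add_re, Complex.ofReal_re, Complex.re_ofReal_mul]
  simp only [zeta]
  ring

theorem norm_airyPhase_sub_mul_I (s x t : ℝ) :
    ‖airyPhase s (x - t * Complex.I)‖ = Real.exp (s * t - x ^ 2 * t + t ^ 3 / 3) := by
  rw [airyPhase, Complex.norm_exp]
  congr 1
  have : Complex.I * (s * ((x : ℂ) - t * Complex.I) - ((x : ℂ) - t * Complex.I) ^ 3 / 3) =
      ((s * t - x ^ 2 * t + t ^ 3 / 3 : ℝ) : ℂ) +
        ((s * x - x ^ 3 / 3 + x * t ^ 2 : ℝ) : ℂ) * Complex.I := by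
    push_cast
    linear_combination (-s * t + (x : ℂ) ^ 2 * t - (x : ℂ) * t ^ 2 * Complex.I
      + (t : ℂ) ^ 3 / 3 * (Complex.I ^ 2 - 1)) * Complex.I_sq
  rw [this, Complex.add_re, Complex.ofReal_re, Complex.re_ofReal_mul]
  simp

theorem airyPhase_re (s y : ℝ) : (airyPhase s y).re = Real.cos (s * y - y ^ 3 / 3) := by
  rw [airyPhase, mul_comm, ← Complex.exp_ofReal_mul_I_re]
  push_cast
  rfl

theorem integrableOn_ray {s : ℝ} (hs : s ≤ 21 / 10) :
    IntegrableOn (fun ρ : ℝ => Complex.exp (-((ρ : ℂ) ^ 3 / 3) + s * zeta * ρ)) (Ioi 0) := by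
  refine Integrable.mono' (integrableOn_exp_cubic (s := s / 2) (by linarith)) (by fun_prop) ?_
  exact ae_of_all _ fun ρ => (norm_exp_ray s ρ).le

theorem integral_exp_neg_mul_le {Y T : ℝ} (hY : 0 < Y) :
    ∫ t in (0 : ℝ)..T, Real.exp (-(Y * t)) ≤ 1 / Y := by
  have h : ∀ t ∈ uIcc 0 T, HasDerivAt (fun t => -(Real.exp (-(Y * t)) / Y)) (Real.exp (-(Y * t))) t := by
    intro t _
    have := (((hasDerivAt_id t).const_mul Y).neg.exp.div_const Y).neg
    refine this.congr_deriv ?_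
    simp only [Pi.neg_apply, id, mul_one]
    field_simp
  rw [intervalIntegral.integral_eq_sub_of_hasDerivAt h
    (Continuous.intervalIntegrable (by fun_prop) _ _)]
  have : 0 < Real.exp (-(Y * T)) / Y := by positivity
  simp only [mul_zero, neg_zero, Real.exp_zero]
  linarith

/-- On the segment from Y down to Y - iY/√3 one has t² ≤ Y²/3, so t³/3 cannot offset -Y²t and the
integrand is at most e^{-Yt}. -/
theorem norm_vertical_le {s Y : ℝ} (hs : s ≤ 21 / 10) (hY : 3 ≤ Y) :
    ‖∫ t in (0 : ℝ)..(Y / Real.sqrt 3), airyPhase s (Y - t * Complex.I) * (-Complex.I)‖ ≤ 1 / Y := by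
  have hT : 0 ≤ Y / Real.sqrt 3 := by positivity
  refine le_trans (intervalIntegral.norm_integral_le_of_norm_le hT
    (g := fun t => Real.exp (-(Y * t))) (ae_of_all _ fun t ht => ?_)
    (Continuous.intervalIntegrable (by fun_prop) _ _)) (integral_exp_neg_mul_le (by linarith))
  rw [norm_mul, norm_neg, Complex.norm_I, mul_one, norm_airyPhase_sub_mul_I]
  apply Real.exp_le_exp.2
  have ht0 : 0 ≤ t := ht.1.le
  have ht2 : t ^ 2 ≤ Y ^ 2 / 3 := by
    have := pow_le_pow_left₀ ht0 ht.2 2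
    rwa [div_pow, Real.sq_sqrt (by norm_num)] at this
  have h1 : t * (s + t ^ 2 / 3 + Y) ≤ t * Y ^ 2 :=
    mul_le_mul_of_nonneg_left (by nlinarith) ht0
  nlinarith

theorem norm_ray_tail_le {s R : ℝ} (hs : s ≤ 21 / 10) (hR : 3 ≤ R) :
    ‖∫ ρ in Ioi R, Complex.exp (-((ρ : ℂ) ^ 3 / 3) + s * zeta * ρ)‖ ≤ Real.exp (-R) := by
  rw [← integral_exp_neg_Ioi R]
  refine norm_integral_le_of_norm_le (integrableOn_exp_neg_Ioi R) ?_
  filter_upwards [ae_restrict_mem measurableSet_Ioi] with ρ hρ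
  rw [norm_exp_ray]
  apply Real.exp_le_exp.2
  have hρ' : R < ρ := hρ
  have h0 : 0 ≤ ρ := by linarith
  have h9 : 9 ≤ ρ ^ 2 := by nlinarith
  nlinarith [mul_le_mul_of_nonneg_left h9 h0]

/-- Cauchy's theorem, via a primitive, on the triangle 0, Y, ωR. The vertical side and the tail of
the ray beyond R each cost at most 1/Y. -/
theorem abs_integral_cos_cubic_sub_le {s Y : ℝ} (hs : s ≤ 21 / 10) (hY : 3 ≤ Y) :
    |(∫ y in (0 : ℝ)..Y, Real.cos (s * y - y ^ 3 / 3)) - (omega * rayIntegral s).re| ≤ 2 / Y := by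
  have hY0 : 0 < Y := by linarith
  have h3 : 0 < Real.sqrt 3 := by positivity
  obtain ⟨F, hF⟩ := (show Differentiable ℂ (airyPhase s) by
    unfold airyPhase; fun_prop).isExactOn_univ
  have hF' : ∀ z, HasDerivAt F (airyPhase s z) z := fun z => hF z (mem_univ z)
  have hcont : Continuous (airyPhase s) := by unfold airyPhase; fun_prop
  -- This R makes Re(ωR) = Y, so the third side is vertical.
  set R := 2 * (Y / Real.sqrt 3) with hR
  have hs32 : Real.sqrt 3 ≤ 2 := by
    rw [Real.sqrt_le_left (by norm_num)]; norm_num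
  have hRY : Y ≤ R := by
    rw [hR, mul_div_assoc', le_div_iff₀ h3]
    nlinarith
  have hcorner : omega * (R : ℂ) = Y - (Y / Real.sqrt 3 : ℝ) * Complex.I := by
    apply Complex.ext
    · simp [omega, hR]; field_simp
    · simp [omega, hR]
  have e1 : ∫ y in (0 : ℝ)..Y, airyPhase s y = F Y - F 0 := by
    rw [intervalIntegral.integral_eq_sub_of_hasDerivAt (f := fun y : ℝ => F y)
      (fun y _ => (hF' y).comp_ofReal)
      (Continuous.intervalIntegrable (hcont.comp Complex.continuous_ofReal) _ _)]
    simp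
  have e2 : ∫ ρ in (0 : ℝ)..R, omega * Complex.exp (-((ρ : ℂ) ^ 3 / 3) + s * zeta * ρ) =
      F (omega * R) - F 0 := by
    have hd : ∀ ρ ∈ uIcc 0 R, HasDerivAt (fun ρ : ℝ => F (omega * ρ))
        (omega * Complex.exp (-((ρ : ℂ) ^ 3 / 3) + s * zeta * ρ)) ρ := by
      intro ρ _
      have hl : HasDerivAt (fun z : ℂ => omega * z) omega (ρ : ℂ) := by
        simpa using (hasDerivAt_id (ρ : ℂ)).const_mul omega
      have := ((hF' (omega * ρ)).comp (ρ : ℂ) hl).comp_ofReal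
      rw [airyPhase_omega_mul, mul_comm] at this
      exact this
    rw [intervalIntegral.integral_eq_sub_of_hasDerivAt hd
      (Continuous.intervalIntegrable (by fun_prop) _ _)]
    simp
  have e3 : ∫ t in (0 : ℝ)..(Y / Real.sqrt 3), airyPhase s (Y - t * Complex.I) * (-Complex.I) =
      F (omega * R) - F Y := by
    have hd : ∀ t ∈ uIcc 0 (Y / Real.sqrt 3), HasDerivAt (fun t : ℝ => F (Y - t * Complex.I))
        (airyPhase s (Y - t * Complex.I) * (-Complex.I)) t := by
      intro t _
      have hl : HasDerivAt (fun z : ℂ => (Y : ℂ) - z * Complex.I) (-Complex.I) (t : ℂ) := by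
        simpa using ((hasDerivAt_id (t : ℂ)).mul_const Complex.I).const_sub (Y : ℂ)
      exact ((hF' (Y - t * Complex.I)).comp (t : ℂ) hl).comp_ofReal
    rw [intervalIntegral.integral_eq_sub_of_hasDerivAt hd
      (Continuous.intervalIntegrable (by fun_prop) _ _), hcorner]
    simp
  have e4 : omega * rayIntegral s = (F (omega * R) - F 0) +
      omega * ∫ ρ in Ioi R, Complex.exp (-((ρ : ℂ) ^ 3 / 3) + s * zeta * ρ) := by
    rw [← e2, intervalIntegral.integral_const_mul, ← mul_add, rayIntegral,
      intervalIntegral.integral_interval_add_Ioi (integrableOn_ray hs)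
        ((integrableOn_ray hs).mono_set (Ioi_subset_Ioi (by linarith)))]
  have e5 : (∫ y in (0 : ℝ)..Y, Real.cos (s * y - y ^ 3 / 3)) =
      (∫ y in (0 : ℝ)..Y, airyPhase s y).re := by
    rw [← Complex.reCLM_apply, ← ContinuousLinearMap.intervalIntegral_comp_comm]
    · simp only [Complex.reCLM_apply, airyPhase_re]
    · exact Continuous.intervalIntegrable (hcont.comp Complex.continuous_ofReal) _ _
  rw [e5, ← Complex.sub_re]
  refine (Complex.abs_re_le_norm _).trans ?_
  rw [e1, e4, show F Y - F 0 - (F (omega * R) - F 0 +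
      omega * ∫ ρ in Ioi R, Complex.exp (-((ρ : ℂ) ^ 3 / 3) + s * zeta * ρ)) =
    -(F (omega * R) - F Y) -
      omega * ∫ ρ in Ioi R, Complex.exp (-((ρ : ℂ) ^ 3 / 3) + s * zeta * ρ) by ring, ← e3]
  refine (norm_sub_le _ _).trans ?_
  rw [norm_neg, norm_mul, norm_omega, one_mul]
  have b1 := norm_vertical_le hs hY
  have b2 := norm_ray_tail_le hs (hY.trans hRY)
  have b3 : Real.exp (-R) ≤ 1 / Y := by
    rw [Real.exp_neg, ← one_div]
    exact one_div_le_one_div_of_le hY0 (by linarith [Real.add_one_le_exp R])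
  have : 2 / Y = 1 / Y + 1 / Y := by ring
  linarith

/-! ### The amplitude of the oscillatory integral -/

/-- The denominator `(1 + h² y²) (1 + b h² y²)`. -/
noncomputable def den (h b y : ℝ) : ℝ := (1 + h ^ 2 * y ^ 2) * (1 + b * (h ^ 2 * y ^ 2))

/-- The phase `ν/2 · log ((1 + h² y²) / (1 + b h² y²))` of the amplitude. -/
noncomputable def logPhase (ν h b y : ℝ) : ℝ :=
  ν / 2 * (Real.log (1 + h ^ 2 * y ^ 2) - Real.log (1 + b * (h ^ 2 * y ^ 2)))

/-- The amplitude `(1 + h² y²)^((iν-1)/2) (1 + b h² y²)^((-iν-1)/2)`. -/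
noncomputable def amplitude (ν h b y : ℝ) : ℂ :=
  ((Real.sqrt (den h b y))⁻¹ : ℝ) * Complex.exp (logPhase ν h b y * Complex.I)

section Basic

variable {ν h b : ℝ}

theorem one_le_den (hb : 0 ≤ b) (y : ℝ) : 1 ≤ den h b y := by
  have h1 : 0 ≤ h ^ 2 * y ^ 2 := by positivity
  have h2 : 0 ≤ b * (h ^ 2 * y ^ 2) := by positivity
  unfold den
  nlinarith

theorem hasDerivAt_factor (c y : ℝ) :
    HasDerivAt (fun y : ℝ => 1 + c * (h ^ 2 * y ^ 2)) (c * (2 * h ^ 2 * y)) y := by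
  refine (((((hasDerivAt_id y).pow 2).const_mul (h ^ 2)).const_mul c).const_add 1).congr_deriv ?_
  simp only [id, mul_one, Nat.cast_ofNat, Nat.add_one_sub_one, pow_one]
  ring

theorem hasDerivAt_den (y : ℝ) : HasDerivAt (den h b)
    (2 * h ^ 2 * y * (1 + b * (h ^ 2 * y ^ 2)) + (1 + h ^ 2 * y ^ 2) * (b * (2 * h ^ 2 * y))) y := by
  have h1 := hasDerivAt_factor (h := h) 1 y
  simp only [one_mul] at h1
  exact h1.mul (hasDerivAt_factor b y)

theorem hasDerivAt_logPhase (hb : 0 ≤ b) (y : ℝ) :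
    HasDerivAt (logPhase ν h b) (ν * (1 - b) * h ^ 2 * y / den h b y) y := by
  have h1 := hasDerivAt_factor (h := h) 1 y
  simp only [one_mul] at h1
  have p1 : (1 + h ^ 2 * y ^ 2) ≠ 0 := by positivity
  have p2 : (1 + b * (h ^ 2 * y ^ 2)) ≠ 0 := by positivity
  refine (((h1.log p1).sub ((hasDerivAt_factor b y).log p2)).const_mul (ν / 2)).congr_deriv ?_
  unfold den
  field_simp
  ring

theorem continuous_den : Continuous (den h b) := by unfold den; fun_prop

theorem continuous_logPhase (hb : 0 ≤ b) : Continuous (logPhase ν h b) :=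
  continuous_iff_continuousAt.2 fun y => (hasDerivAt_logPhase hb y).continuousAt

theorem sqrt_den_pos (hb : 0 ≤ b) (y : ℝ) : 0 < Real.sqrt (den h b y) :=
  Real.sqrt_pos.2 (one_pos.trans_le (one_le_den hb y))

theorem continuous_amplitude (hb : 0 ≤ b) : Continuous (amplitude ν h b) := by
  have h1 := continuous_logPhase (ν := ν) (h := h) hb
  have h2 : Continuous fun y => (Real.sqrt (den h b y))⁻¹ :=
    continuous_den.sqrt.inv₀ fun y => (sqrt_den_pos hb y).ne'
  unfold amplitude
  fun_prop

theorem norm_amplitude (y : ℝ) : ‖amplitude ν h b y‖ = (Real.sqrt (den h b y))⁻¹ := by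
  rw [amplitude, norm_mul, Complex.norm_exp_ofReal_mul_I, mul_one, Complex.norm_real,
    Real.norm_of_nonneg (by positivity)]

end Basic

/-! ### Integration by parts away from the stationary point -/

section Tail

variable {ν h b s : ℝ}

/-- The modulus of the quotient of the amplitude by the derivative of the phase. -/
noncomputable def quot (h b s y : ℝ) : ℝ := Real.sqrt (den h b y) / (y ^ 2 - s)

/-- The derivative of `quot`. -/
noncomputable def quotDeriv (h b s y : ℝ) : ℝ :=
  ((2 * h ^ 2 * y * (1 + b * (h ^ 2 * y ^ 2)) + (1 + h ^ 2 * y ^ 2) * (b * (2 * h ^ 2 * y))) /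
    (2 * Real.sqrt (den h b y)) * (y ^ 2 - s) - Real.sqrt (den h b y) * (2 * y)) / (y ^ 2 - s) ^ 2

theorem hasDerivAt_quot (hb : 0 ≤ b) {y : ℝ} (hy : y ^ 2 - s ≠ 0) :
    HasDerivAt (quot h b s) (quotDeriv h b s y) y := by
  have h1 := (hasDerivAt_den (h := h) (b := b) y).sqrt (one_pos.trans_le (one_le_den hb y)).ne'
  have h2 : HasDerivAt (fun y : ℝ => y ^ 2 - s) (2 * y) y := by
    simpa using ((hasDerivAt_id y).pow 2).sub_const s
  exact h1.div h2 hy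

/-- The logarithmic derivative of √`den` is at most 2/y, that of y² - s at least 2/y. Monotonicity
lets the total variation of `quot` telescope. -/
theorem quotDeriv_nonpos (hb : 0 ≤ b) (hs0 : 0 ≤ s) {y : ℝ} (hy0 : 0 < y) (hy : 0 < y ^ 2 - s) :
    quotDeriv h b s y ≤ 0 := by
  have hq := sqrt_den_pos (h := h) hb y
  have hsq : Real.sqrt (den h b y) * Real.sqrt (den h b y) = den h b y :=
    Real.mul_self_sqrt (one_pos.trans_le (one_le_den hb y)).le
  refine div_nonpos_of_nonpos_of_nonneg ?_ (by positivity)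
  rw [sub_nonpos, div_mul_eq_mul_div, div_le_iff₀ (by positivity)]
  set d := 2 * h ^ 2 * y * (1 + b * (h ^ 2 * y ^ 2)) + (1 + h ^ 2 * y ^ 2) * (b * (2 * h ^ 2 * y))
    with hd
  have hd0 : 0 ≤ d := by positivity
  have h1 : d * (y ^ 2 - s) ≤ d * y ^ 2 := mul_le_mul_of_nonneg_left (by linarith) hd0
  have h2 : d * y ^ 2 ≤ 4 * y * den h b y := by
    have hx : 0 ≤ h ^ 2 * y ^ 2 := by positivity
    have : 4 * y * den h b y - d * y ^ 2 =
        2 * y * (2 + (h ^ 2 * y ^ 2) + b * (h ^ 2 * y ^ 2)) := by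
      rw [hd, den]; ring
    have : 0 ≤ 2 * y * (2 + (h ^ 2 * y ^ 2) + b * (h ^ 2 * y ^ 2)) := by positivity
    linarith
  calc d * (y ^ 2 - s) ≤ 4 * y * den h b y := h1.trans h2
    _ = Real.sqrt (den h b y) * (2 * y) * (2 * Real.sqrt (den h b y)) := by
      linear_combination (-4 * y) * hsq

theorem continuousOn_quotDeriv (hb : 0 ≤ b) {S : Set ℝ} (hS : ∀ y ∈ S, y ^ 2 - s ≠ 0) :
    ContinuousOn (quotDeriv h b s) S := by
  have h1 : Continuous fun y => Real.sqrt (den h b y) := continuous_den.sqrt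
  have h2 : ∀ y, 2 * Real.sqrt (den h b y) ≠ 0 := fun y => by
    have := sqrt_den_pos (h := h) hb y
    positivity
  unfold quotDeriv
  refine ContinuousOn.div ?_ (by fun_prop) fun y hy => pow_ne_zero 2 (hS y hy)
  refine Continuous.continuousOn ?_
  refine ((Continuous.div (by fun_prop) (by fun_prop) h2).mul (by fun_prop)).sub (by fun_prop)

theorem two_mul_sub_ge (hs : s ≤ 21 / 10) {y : ℝ} (hy : 3 ≤ y) : y ^ 2 ≤ 2 * (y ^ 2 - s) := by
  nlinarith

/-- Integration by parts on the range where the phase has no stationary point. -/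
theorem norm_tail_le (hh : 0 < h) (hh1 : h ≤ 1) (hb : 0 ≤ b) (hb1 : b ≤ 1) (hs0 : 0 ≤ s)
    (hs : s ≤ 21 / 10) {Φ : ℝ → ℝ} (hΦ : ∀ y, HasDerivAt Φ ((s - y ^ 2) / den h b y) y)
    {Y R : ℝ} (hY : 3 ≤ Y) (hYR : Y ≤ R) (hhY : h * Y ≤ 1) :
    ‖∫ y in Y..R, (Real.cos (Φ y) : ℂ) * amplitude ν h b y‖ ≤ (3 + 2 * |ν|) / Y := by
  have hpos : ∀ y ∈ uIcc Y R, 3 ≤ y := fun y hy => by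
    rw [uIcc_of_le hYR] at hy
    exact hY.trans hy.1
  have hne : ∀ y ∈ uIcc Y R, 0 < y ^ 2 - s := fun y hy => by
    have := hpos y hy
    nlinarith
  have hcΦ : Continuous Φ := continuous_iff_continuousAt.2 fun y => (hΦ y).continuousAt
  have hcL := continuous_logPhase (ν := ν) (h := h) hb
  have hcA := continuous_amplitude (ν := ν) (h := h) hb
  let E : ℝ → ℂ := fun y => Complex.exp (logPhase ν h b y * Complex.I)
  -- V is the amplitude divided by Φ', so that V · (sin Φ)' = cos Φ · amplitude.
  let V : ℝ → ℂ := fun y => -((quot h b s y : ℂ) * E y)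
  let θ' : ℝ → ℝ := fun y => ν * (1 - b) * h ^ 2 * y / den h b y
  let V' : ℝ → ℂ := fun y =>
    -((quotDeriv h b s y : ℂ) * E y + (quot h b s y : ℂ) * (E y * (θ' y * Complex.I)))
  have hE : ∀ y, HasDerivAt E (E y * (θ' y * Complex.I)) y := fun y =>
    (((hasDerivAt_logPhase hb y).ofReal_comp).mul_const Complex.I).cexp
  have hV : ∀ y ∈ uIcc Y R, HasDerivAt V (V' y) y := fun y hy =>
    ((hasDerivAt_quot hb (hne y hy).ne').ofReal_comp.mul (hE y)).neg
  have hS : ∀ y, HasDerivAt (fun y => (Real.sin (Φ y) : ℂ))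
      ((Real.cos (Φ y) * ((s - y ^ 2) / den h b y) : ℝ) : ℂ) y := fun y =>
    (hΦ y).sin.ofReal_comp
  have hcE : Continuous E := by fun_prop
  have hcθ : Continuous θ' := Continuous.div (by fun_prop) continuous_den fun y =>
    (one_pos.trans_le (one_le_den hb y)).ne'
  have hcq : ContinuousOn (quot h b s) (uIcc Y R) := fun y hy =>
    (hasDerivAt_quot hb (hne y hy).ne').continuousAt.continuousWithinAt
  have hcq' : ContinuousOn (quotDeriv h b s) (uIcc Y R) :=
    continuousOn_quotDeriv hb fun y hy => (hne y hy).ne'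
  have hcV' : ContinuousOn V' (uIcc Y R) := by
    refine ContinuousOn.neg (ContinuousOn.add (ContinuousOn.mul ?_ hcE.continuousOn)
      (ContinuousOn.mul ?_ (by fun_prop)))
    · exact Complex.continuous_ofReal.comp_continuousOn hcq'
    · exact Complex.continuous_ofReal.comp_continuousOn hcq
  have hSV : ∀ y ∈ uIcc Y R, HasDerivAt (fun y => (Real.sin (Φ y) : ℂ) * V y)
      ((Real.cos (Φ y) : ℂ) * amplitude ν h b y + (Real.sin (Φ y) : ℂ) * V' y) y := by
    intro y hy
    refine ((hS y).mul (hV y hy)).congr_deriv ?_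
    congr 1
    have hq := sqrt_den_pos (h := h) hb y
    have hsq : den h b y = Real.sqrt (den h b y) * Real.sqrt (den h b y) :=
      (Real.mul_self_sqrt (one_pos.trans_le (one_le_den hb y)).le).symm
    have hr : (s - y ^ 2) / den h b y * -quot h b s y = (Real.sqrt (den h b y))⁻¹ := by
      have h0 := (hne y hy).ne'
      rw [quot]
      nth_rewrite 1 [hsq]
      field_simp
      ring
    rw [amplitude, ← hr]
    simp only [V, E]
    push_cast
    ring
  have hcS : Continuous fun y => (Real.sin (Φ y) : ℂ) := by fun_prop
  have hcC : Continuous fun y => (Real.cos (Φ y) : ℂ) * amplitude ν h b y := by fun_prop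
  have hiC : IntervalIntegrable (fun y => (Real.cos (Φ y) : ℂ) * amplitude ν h b y) volume Y R :=
    hcC.intervalIntegrable _ _
  have hiS : IntervalIntegrable (fun y => (Real.sin (Φ y) : ℂ) * V' y) volume Y R :=
    (hcS.continuousOn.mul hcV').intervalIntegrable
  have hparts := intervalIntegral.integral_eq_sub_of_hasDerivAt hSV (hiC.add hiS)
  rw [intervalIntegral.integral_add hiC hiS] at hparts
  -- B' dominates |V'|: the decrease of `quot` telescopes and the factor E contributes at most
  -- 2|ν|/y². In the final sum `quot` at R cancels, which makes the bound independent of R.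
  let B : ℝ → ℝ := fun y => -quot h b s y - 2 * |ν| * y⁻¹
  let B' : ℝ → ℝ := fun y => -quotDeriv h b s y + 2 * |ν| / y ^ 2
  have hB : ∀ y ∈ uIcc Y R, HasDerivAt B (B' y) y := by
    intro y hy
    have hy0 : y ≠ 0 := by have := hpos y hy; positivity
    refine ((hasDerivAt_quot hb (hne y hy).ne').neg.sub
      ((hasDerivAt_inv hy0).const_mul (2 * |ν|))).congr_deriv ?_
    simp only [B']
    ring
  have hiB : IntervalIntegrable B' volume Y R := by
    refine ContinuousOn.intervalIntegrable (hcq'.neg.add ?_)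
    refine ContinuousOn.div (by fun_prop) (by fun_prop) fun y hy => ?_
    have := hpos y hy
    positivity
  have hqpos : ∀ y ∈ uIcc Y R, 0 < quot h b s y := fun y hy =>
    div_pos (sqrt_den_pos hb y) (hne y hy)
  have hbound : ∀ y ∈ uIcc Y R, ‖(Real.sin (Φ y) : ℂ) * V' y‖ ≤ B' y := by
    intro y hy
    have hy3 := hpos y hy
    have hy0 : 0 < y := by linarith
    have hE1 : ‖E y‖ = 1 := Complex.norm_exp_ofReal_mul_I _
    have hsin : ‖(Real.sin (Φ y) : ℂ)‖ ≤ 1 := by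
      rw [Complex.norm_real]
      exact Real.abs_sin_le_one _
    have hθ : quot h b s y * |θ' y| ≤ 2 * |ν| / y ^ 2 := by
      have hq := sqrt_den_pos (h := h) hb y
      have hsq : Real.sqrt (den h b y) * Real.sqrt (den h b y) = den h b y :=
        Real.mul_self_sqrt (one_pos.trans_le (one_le_den hb y)).le
      have hhy : h * y ≤ Real.sqrt (den h b y) := by
        refine Real.le_sqrt_of_sq_le ?_
        have : 0 ≤ b * (h ^ 2 * y ^ 2) := by positivity
        unfold den
        nlinarith [mul_nonneg (sq_nonneg (h * y)) this]
      have e : quot h b s y * |θ' y| =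
          |ν| * ((1 - b) * h) * ((h * y) / Real.sqrt (den h b y)) / (y ^ 2 - s) := by
        simp only [θ', quot]
        rw [abs_div, abs_mul, abs_mul, abs_mul, abs_of_nonneg (sub_nonneg.2 hb1),
          abs_of_pos hy0, abs_of_pos (pow_pos hh 2), abs_of_pos (one_pos.trans_le (one_le_den hb y))]
        have h0 := (hne y hy).ne'
        nth_rewrite 2 [← hsq]
        field_simp
      rw [e]
      have h2 := two_mul_sub_ge hs hy3
      have h3 : (1 - b) * h ≤ 1 := by nlinarith
      have h4 : (h * y) / Real.sqrt (den h b y) ≤ 1 := (div_le_one hq).2 hhy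
      have h5 : 0 ≤ (1 - b) * h := mul_nonneg (by linarith) hh.le
      have h6 : |ν| * ((1 - b) * h) * ((h * y) / Real.sqrt (den h b y)) ≤ |ν| := by
        rw [mul_assoc]
        refine mul_le_of_le_one_right (abs_nonneg _) (mul_le_one₀ h3 (by positivity) h4)
      rw [div_le_div_iff₀ (hne y hy) (by positivity)]
      nlinarith [mul_le_mul h6 h2 (by positivity) (abs_nonneg ν)]
    have hq' := quotDeriv_nonpos (h := h) hb hs0 hy0 (hne y hy)
    calc ‖(Real.sin (Φ y) : ℂ) * V' y‖ ≤ ‖V' y‖ := by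
          rw [norm_mul]
          exact mul_le_of_le_one_left (norm_nonneg _) hsin
      _ ≤ |quotDeriv h b s y| + |quot h b s y| * |θ' y| := by
          simp only [V', norm_neg]
          refine (norm_add_le _ _).trans (le_of_eq ?_)
          simp [hE1]
      _ ≤ B' y := by
          rw [abs_of_nonpos hq', abs_of_pos (hqpos y hy)]
          simp only [B']
          linarith
  have hI : ‖∫ y in Y..R, (Real.sin (Φ y) : ℂ) * V' y‖ ≤ B R - B Y := by
    rw [← intervalIntegral.integral_eq_sub_of_hasDerivAt hB hiB]
    refine intervalIntegral.norm_integral_le_of_norm_le hYR (ae_of_all _ fun y hy => ?_) hiB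
    refine hbound y ?_
    rw [uIcc_of_le hYR]
    exact Ioc_subset_Icc_self hy
  have hSVn : ∀ y ∈ uIcc Y R, ‖(Real.sin (Φ y) : ℂ) * V y‖ ≤ quot h b s y := by
    intro y hy
    have hE1 : ‖E y‖ = 1 := Complex.norm_exp_ofReal_mul_I _
    rw [norm_mul, norm_neg, norm_mul, hE1, mul_one, Complex.norm_real, Complex.norm_real,
      Real.norm_of_nonneg (hqpos y hy).le]
    exact mul_le_of_le_one_left (hqpos y hy).le (Real.abs_sin_le_one _)
  have hq4 : quot h b s Y ≤ 4 / Y ^ 2 := by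
    have h2 := two_mul_sub_ge hs hY
    have h3 : Real.sqrt (den h b Y) ≤ 2 := by
      rw [Real.sqrt_le_left (by norm_num)]
      have h4 : h ^ 2 * Y ^ 2 ≤ 1 := by
        rw [← mul_pow]
        exact pow_le_one₀ (by positivity) hhY
      have h5 : b * (h ^ 2 * Y ^ 2) ≤ 1 := mul_le_one₀ hb1 (by positivity) h4
      unfold den
      nlinarith [show 0 ≤ h ^ 2 * Y ^ 2 by positivity, mul_nonneg hb (show 0 ≤ h ^ 2 * Y ^ 2 by positivity)]
    rw [quot, div_le_div_iff₀ (hne Y left_mem_uIcc) (by positivity)]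
    nlinarith [mul_le_mul_of_nonneg_right h3 (show 0 ≤ Y ^ 2 by positivity)]
  have hfin : ‖∫ y in Y..R, (Real.cos (Φ y) : ℂ) * amplitude ν h b y‖ ≤
      quot h b s R + quot h b s Y + (B R - B Y) := by
    rw [eq_sub_of_add_eq hparts]
    refine (norm_sub_le _ _).trans (add_le_add ((norm_sub_le _ _).trans ?_) hI)
    exact add_le_add (hSVn R right_mem_uIcc) (hSVn Y left_mem_uIcc)
  refine hfin.trans ?_
  have hR0 : 0 ≤ 2 * |ν| * R⁻¹ := by
    have : 0 < R := by linarith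
    positivity
  have h8 : 8 / Y ^ 2 ≤ 3 / Y := by
    rw [div_le_div_iff₀ (by positivity) (by linarith)]
    nlinarith
  have h9 : (3 + 2 * |ν|) / Y = 3 / Y + 2 * |ν| * Y⁻¹ := by rw [add_div, div_eq_mul_inv (2 * |ν|)]
  have h10 : 8 / Y ^ 2 = 2 * (4 / Y ^ 2) := by ring
  rw [h9]
  simp only [B]
  linarith

end Tail

/-! ### Comparison with the Airy integral on a bounded range -/

section Comparison

variable {ν h b s : ℝ}

theorem den_sub_one_le {y Y : ℝ} (hb : 0 ≤ b) (hb1 : b ≤ 1) (hh : 0 ≤ h) (hy : 0 ≤ y) (hyY : y ≤ Y)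
    (hhY : h * Y ≤ 1) : den h b y - 1 ≤ 3 * (h ^ 2 * Y ^ 2) := by
  have hx0 : 0 ≤ h ^ 2 * y ^ 2 := by positivity
  have hxX : h ^ 2 * y ^ 2 ≤ h ^ 2 * Y ^ 2 := by gcongr
  have hX1 : h ^ 2 * Y ^ 2 ≤ 1 := by
    rw [← mul_pow]
    exact pow_le_one₀ (mul_nonneg hh (hy.trans hyY)) hhY
  have h1 : b * (h ^ 2 * y ^ 2) ≤ h ^ 2 * y ^ 2 := mul_le_of_le_one_left hx0 hb1
  have h2 : 0 ≤ b * (h ^ 2 * y ^ 2) := by positivity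
  unfold den
  nlinarith

theorem abs_logPhase_le (hb : 0 ≤ b) (hb1 : b ≤ 1) (y : ℝ) :
    |logPhase ν h b y| ≤ |ν| * (h ^ 2 * y ^ 2) := by
  have hx0 : 0 ≤ h ^ 2 * y ^ 2 := by positivity
  have h1 : b * (h ^ 2 * y ^ 2) ≤ h ^ 2 * y ^ 2 := mul_le_of_le_one_left hx0 hb1
  have h2 : 0 ≤ b * (h ^ 2 * y ^ 2) := by positivity
  have l1 : Real.log (1 + h ^ 2 * y ^ 2) ≤ h ^ 2 * y ^ 2 := by
    have := Real.log_le_sub_one_of_pos (show 0 < 1 + h ^ 2 * y ^ 2 by positivity)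
    linarith
  have l2 : 0 ≤ Real.log (1 + b * (h ^ 2 * y ^ 2)) := Real.log_nonneg (by linarith)
  have l3 : Real.log (1 + b * (h ^ 2 * y ^ 2)) ≤ Real.log (1 + h ^ 2 * y ^ 2) :=
    Real.log_le_log (by linarith) (by linarith)
  rw [logPhase, abs_mul, abs_of_nonneg (sub_nonneg.2 l3), abs_div, abs_of_pos (two_pos (α := ℝ))]
  have := abs_nonneg ν
  nlinarith

theorem norm_amplitude_sub_one_le {y Y : ℝ} (hb : 0 ≤ b) (hb1 : b ≤ 1) (hh : 0 ≤ h) (hy : 0 ≤ y)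
    (hyY : y ≤ Y) (hhY : h * Y ≤ 1) :
    ‖amplitude ν h b y - 1‖ ≤ (|ν| + 3) * (h ^ 2 * Y ^ 2) := by
  have hq := sqrt_den_pos (h := h) hb y
  have hq1 : 1 ≤ Real.sqrt (den h b y) := Real.one_le_sqrt.2 (one_le_den hb y)
  have hqd : Real.sqrt (den h b y) * Real.sqrt (den h b y) = den h b y :=
    Real.mul_self_sqrt (one_pos.trans_le (one_le_den hb y)).le
  have hi1 : (Real.sqrt (den h b y))⁻¹ ≤ 1 := inv_le_one_of_one_le₀ hq1
  have hi0 : 0 ≤ (Real.sqrt (den h b y))⁻¹ := by positivity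
  have hi2 : 1 - (Real.sqrt (den h b y))⁻¹ ≤ 3 * (h ^ 2 * Y ^ 2) := by
    refine le_trans ?_ (den_sub_one_le hb hb1 hh hy hyY hhY)
    have : Real.sqrt (den h b y) * (Real.sqrt (den h b y))⁻¹ = 1 := mul_inv_cancel₀ hq.ne'
    nlinarith
  have e : amplitude ν h b y - 1 = ((Real.sqrt (den h b y))⁻¹ : ℝ) *
      (Complex.exp (logPhase ν h b y * Complex.I) - 1) +
        (((Real.sqrt (den h b y))⁻¹ - 1 : ℝ) : ℂ) := by
    rw [amplitude]
    push_cast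
    ring
  rw [e]
  refine (norm_add_le _ _).trans ?_
  have h1 : ‖Complex.exp (logPhase ν h b y * Complex.I) - 1‖ ≤ |ν| * (h ^ 2 * Y ^ 2) := by
    rw [mul_comm _ Complex.I]
    refine (Real.norm_exp_I_mul_ofReal_sub_one_le).trans ((abs_logPhase_le hb hb1 y).trans ?_)
    gcongr
  rw [norm_mul, Complex.norm_real, Complex.norm_real, Real.norm_of_nonneg hi0, Real.norm_eq_abs,
    abs_of_nonpos (by linarith)]
  have := mul_le_of_le_one_left (norm_nonneg (Complex.exp (logPhase ν h b y * Complex.I) - 1)) hi1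
  linarith

/-- Mean value inequality: the derivatives differ by (s - t²)(1/`den` - 1). -/
theorem abs_phase_sub_cubic_le {y Y : ℝ} (hb : 0 ≤ b) (hb1 : b ≤ 1) (hh : 0 ≤ h) (hy : 0 ≤ y)
    (hyY : y ≤ Y) (hhY : h * Y ≤ 1) (hs0 : 0 ≤ s) (hs : s ≤ 21 / 10) {Φ : ℝ → ℝ} (hΦ0 : Φ 0 = 0)
    (hΦ : ∀ y, HasDerivAt Φ ((s - y ^ 2) / den h b y) y) :
    |Φ y - (s * y - y ^ 3 / 3)| ≤ (3 + Y ^ 2) * (3 * (h ^ 2 * Y ^ 2)) * Y := by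
  have hd : ∀ t, HasDerivAt (fun y => Φ y - (s * y - y ^ 3 / 3))
      ((s - t ^ 2) / den h b t - (s - t ^ 2)) t := by
    intro t
    refine ((hΦ t).sub (((hasDerivAt_id t).const_mul s).sub
      (((hasDerivAt_id t).pow 3).div_const 3))).congr_deriv ?_
    simp only [id, mul_one, Nat.cast_ofNat, Nat.add_one_sub_one]
    ring
  have hbd : ∀ t ∈ Ico 0 y, ‖(s - t ^ 2) / den h b t - (s - t ^ 2)‖ ≤
      (3 + Y ^ 2) * (3 * (h ^ 2 * Y ^ 2)) := by
    intro t ht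
    have h1 := one_le_den (h := h) hb t
    have h2 := den_sub_one_le hb hb1 hh ht.1 (ht.2.le.trans hyY) hhY
    have e : (s - t ^ 2) / den h b t - (s - t ^ 2) =
        -((s - t ^ 2) * ((den h b t - 1) / den h b t)) := by
      field_simp
      ring
    rw [e, norm_neg, norm_mul, Real.norm_eq_abs, Real.norm_eq_abs]
    have ht2 : t ^ 2 ≤ Y ^ 2 := pow_le_pow_left₀ ht.1 (ht.2.le.trans hyY) 2
    refine mul_le_mul (abs_le.2 ⟨by nlinarith, by nlinarith⟩) ?_ (abs_nonneg _) (by positivity)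
    rw [abs_of_nonneg (div_nonneg (by linarith) (by linarith))]
    exact (div_le_self (by linarith) h1).trans h2
  have := norm_image_sub_le_of_norm_deriv_le_segment' (a := 0) (b := y)
    (fun t _ => (hd t).hasDerivWithinAt) hbd y (right_mem_Icc.2 hy)
  simp only [hΦ0, mul_zero, sub_zero, ne_eq, OfNat.ofNat_ne_zero, not_false_eq_true, zero_pow,
    zero_div, Real.norm_eq_abs] at this
  exact this.trans (mul_le_mul_of_nonneg_left hyY (by positivity))

/-- On a bounded range the oscillatory integral is close to the truncated Airy integral. -/
theorem norm_integral_sub_airy_le {Y : ℝ} (hb : 0 ≤ b) (hb1 : b ≤ 1) (hh : 0 ≤ h) (hY : 0 ≤ Y)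
    (hhY : h * Y ≤ 1) (hs0 : 0 ≤ s) (hs : s ≤ 21 / 10) {Φ : ℝ → ℝ} (hΦ0 : Φ 0 = 0)
    (hΦ : ∀ y, HasDerivAt Φ ((s - y ^ 2) / den h b y) y) :
    ‖(∫ y in (0 : ℝ)..Y, (Real.cos (Φ y) : ℂ) * amplitude ν h b y) -
      ((∫ y in (0 : ℝ)..Y, Real.cos (s * y - y ^ 3 / 3) : ℝ) : ℂ)‖ ≤
      h ^ 2 * (((3 + Y ^ 2) * (3 * Y ^ 2) * Y + (|ν| + 3) * Y ^ 2) * Y) := by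
  have hcΦ : Continuous Φ := continuous_iff_continuousAt.2 fun y => (hΦ y).continuousAt
  have hcA := continuous_amplitude (ν := ν) (h := h) hb
  rw [← intervalIntegral.integral_ofReal, ← intervalIntegral.integral_sub
    (Continuous.intervalIntegrable (by fun_prop) _ _)
    (Continuous.intervalIntegrable (by fun_prop) _ _)]
  refine (intervalIntegral.norm_integral_le_of_norm_le_const
    (C := h ^ 2 * ((3 + Y ^ 2) * (3 * Y ^ 2) * Y + (|ν| + 3) * Y ^ 2)) fun y hy => ?_).trans
    (le_of_eq ?_)
  · rw [uIoc_of_le hY] at hy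
    have h1 := abs_phase_sub_cubic_le hb hb1 hh hy.1.le hy.2 hhY hs0 hs hΦ0 hΦ
    have h2 := norm_amplitude_sub_one_le (ν := ν) hb hb1 hh hy.1.le hy.2 hhY
    have h3 : |Real.cos (Φ y) - Real.cos (s * y - y ^ 3 / 3)| ≤ |Φ y - (s * y - y ^ 3 / 3)| := by
      simpa [Real.dist_eq] using Real.lipschitzWith_cos.dist_le_mul (Φ y) (s * y - y ^ 3 / 3)
    have e : (Real.cos (Φ y) : ℂ) * amplitude ν h b y - (Real.cos (s * y - y ^ 3 / 3) : ℂ) =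
        (Real.cos (Φ y) : ℂ) * (amplitude ν h b y - 1) +
          ((Real.cos (Φ y) - Real.cos (s * y - y ^ 3 / 3) : ℝ) : ℂ) := by
      push_cast
      ring
    rw [e]
    refine (norm_add_le _ _).trans ?_
    rw [norm_mul, Complex.norm_real, Complex.norm_real, Real.norm_eq_abs, Real.norm_eq_abs]
    have h4 := mul_le_of_le_one_left (norm_nonneg (amplitude ν h b y - 1))
      (Real.abs_cos_le_one (Φ y))
    linarith
  · rw [sub_zero, abs_of_nonneg hY]
    ring

/-- Uniform lower bound for the truncated oscillatory integrals. -/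
theorem exists_le_norm_integral (ν : ℝ) :
    ∃ c : ℝ, 0 < c ∧ ∃ h₀ : ℝ, 0 < h₀ ∧ ∃ Y : ℝ, ∀ h b s : ℝ, 0 < h → h ≤ h₀ → 0 ≤ b → b ≤ 1 →
      0 ≤ s → s ≤ 21 / 10 → ∀ Φ : ℝ → ℝ, Φ 0 = 0 →
      (∀ y, HasDerivAt Φ ((s - y ^ 2) / den h b y) y) → ∀ R : ℝ, Y ≤ R →
      c ≤ ‖∫ y in (0 : ℝ)..R, (Real.cos (Φ y) : ℂ) * amplitude ν h b y‖ := by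
  obtain ⟨c, hc, hairy⟩ := exists_le_omega_mul_rayIntegral_re
  have hν := abs_nonneg ν
  -- Y makes the tail (3 + 2|ν|)/Y and the contour error 2/Y total at most c/4; h₀ below makes the
  -- comparison error at most c/4, leaving c/2.
  set Y : ℝ := 3 + 4 * (5 + 2 * |ν|) / c with hYdef
  have hY3 : 3 ≤ Y := by
    rw [hYdef]
    have : 0 ≤ 4 * (5 + 2 * |ν|) / c := by positivity
    linarith
  have hY0 : 0 < Y := by linarith
  have hYc : (5 + 2 * |ν|) / Y ≤ c / 4 := by
    rw [div_le_iff₀ hY0, hYdef]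
    field_simp
    nlinarith
  set K : ℝ := ((3 + Y ^ 2) * (3 * Y ^ 2) * Y + (|ν| + 3) * Y ^ 2) * Y with hK
  have hK0 : 0 < K := by positivity
  refine ⟨c / 2, by positivity, min (1 / Y) (c / (4 * K)), by positivity, Y, ?_⟩
  intro h b s hh hhle hb hb1 hs0 hs Φ hΦ0 hΦ R hR
  have hhY : h * Y ≤ 1 := (le_div_iff₀ hY0).1 (hhle.trans (min_le_left _ _))
  have hhK : h * K ≤ c / 4 := by
    have := (le_div_iff₀ (by positivity)).1 (hhle.trans (min_le_right _ _))
    linarith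
  have hh1 : h ≤ 1 := by nlinarith
  have hcΦ : Continuous Φ := continuous_iff_continuousAt.2 fun y => (hΦ y).continuousAt
  have hcA := continuous_amplitude (ν := ν) (h := h) hb
  have hcC : Continuous fun y => (Real.cos (Φ y) : ℂ) * amplitude ν h b y := by fun_prop
  rw [← intervalIntegral.integral_add_adjacent_intervals (hcC.intervalIntegrable 0 Y)
    (hcC.intervalIntegrable Y R)]
  have t1 := norm_tail_le (ν := ν) hh hh1 hb hb1 hs0 hs hΦ hY3 hR hhY
  have t2 := norm_integral_sub_airy_le (ν := ν) hb hb1 hh.le hY0.le hhY hs0 hs hΦ0 hΦ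
  have t3 := abs_le.1 (abs_integral_cos_cubic_sub_le hs hY3)
  have t4 := hairy s hs0 hs
  set T := ∫ y in Y..R, (Real.cos (Φ y) : ℂ) * amplitude ν h b y
  set S := ∫ y in (0 : ℝ)..Y, (Real.cos (Φ y) : ℂ) * amplitude ν h b y
  set A := ∫ y in (0 : ℝ)..Y, Real.cos (s * y - y ^ 3 / 3)
  have t5 : h ^ 2 * K ≤ c / 4 := by nlinarith [mul_pos hh hK0]
  have t6 : A ≤ ‖(A : ℂ)‖ := by
    rw [Complex.norm_real]
    exact le_abs_self A
  have t7 : ‖(A : ℂ)‖ ≤ ‖S + T‖ + ‖S - A‖ + ‖T‖ := by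
    have e : (A : ℂ) = (S + T) - (S - A) - T := by ring
    calc ‖(A : ℂ)‖ = ‖(S + T) - (S - A) - T‖ := by rw [← e]
      _ ≤ _ := (norm_sub_le _ _).trans (add_le_add_left (norm_sub_le _ _) _)
  have t8 : (5 + 2 * |ν|) / Y = (3 + 2 * |ν|) / Y + 2 / Y := by ring
  linarith

end Comparison

/-! ### The matrix coefficient as an oscillatory integral -/

/-- Positive homogeneity of the vectors `e_n`. -/
theorem kType_smul_of_pos (l : ℂ) (n : ℤ) {c : ℝ} (hc : 0 < c) (v : Fin 2 → ℝ) :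
    kType l n (c • v) = (c : ℂ) ^ (l - 1) * kType l n v := by
  have hs : Real.sqrt ((c * v 0) ^ 2 + (c * v 1) ^ 2) = c * Real.sqrt (v 0 ^ 2 + v 1 ^ 2) := by
    rw [show (c * v 0) ^ 2 + (c * v 1) ^ 2 = c ^ 2 * (v 0 ^ 2 + v 1 ^ 2) by ring,
      Real.sqrt_mul (sq_nonneg c), Real.sqrt_sq hc.le]
  have hcc : (c : ℂ) ≠ 0 := by exact_mod_cast hc.ne'
  simp only [kType, Pi.smul_apply, smul_eq_mul, hs]
  rw [Complex.ofReal_mul c (Real.sqrt _), Complex.mul_cpow_ofReal_nonneg hc.le (Real.sqrt_nonneg _),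
    show ((c * v 1 : ℝ) : ℂ) + ((c * v 0 : ℝ) : ℂ) * Complex.I =
      (c : ℂ) * ((v 1 : ℂ) + v 0 * Complex.I) by push_cast; ring, mul_div_mul_left _ _ hcc]
  ring

/-- [a]⁻¹(t, 1) = a⁻¹(a²t, 1), and [a] has determinant 1. -/
theorem action_diagElt_kType_line (l : ℂ) {a : ℝ} (ha : 0 < a) (m : ℤ) (t : ℝ) :
    action l (diagElt a ha) (kType l m) ![t, 1] =
      ((a⁻¹ : ℝ) : ℂ) ^ (l - 1) * kType l m ![a ^ 2 * t, 1] := by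
  have hg : ((diagElt a ha : GL (Fin 2) ℝ) : Matrix (Fin 2) (Fin 2) ℝ) = !![a⁻¹, 0; 0, a] := rfl
  have hdet : ((diagElt a ha : GL (Fin 2) ℝ) : Matrix (Fin 2) (Fin 2) ℝ).det = 1 := by
    rw [hg, Matrix.det_fin_two_of]
    simp [ha.ne']
  have hv : (![t, 1] : Fin 2 → ℝ) =
      ((diagElt a ha : GL (Fin 2) ℝ) : Matrix (Fin 2) (Fin 2) ℝ).mulVec
        (a⁻¹ • ![a ^ 2 * t, 1]) := by
    rw [hg]
    ext i
    fin_cases i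
    · simp [Matrix.mulVec, dotProduct, Fin.sum_univ_two]
      field_simp
    · simp [Matrix.mulVec, dotProduct, Fin.sum_univ_two, ha.ne']
  have hinv : (((diagElt a ha)⁻¹ : GL (Fin 2) ℝ) : Matrix (Fin 2) (Fin 2) ℝ).mulVec ![t, 1] =
      a⁻¹ • ![a ^ 2 * t, 1] := by
    rw [hv, Matrix.mulVec_mulVec, ← Units.val_mul, inv_mul_cancel, Units.val_one,
      Matrix.one_mulVec]
  simp only [action, MonoidHom.coe_mk, OneHom.coe_mk, LinearMap.coe_mk, AddHom.coe_mk, hdet, hinv]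
  rw [kType_smul_of_pos l m (inv_pos.2 ha)]
  simp

/-- The phase `m arctan (h y) - n arctan (h y / a²)`. -/
noncomputable def arctanPhase (m n h a y : ℝ) : ℝ :=
  m * Real.arctan (h * y) - n * Real.arctan (h / a ^ 2 * y)

theorem amplitude_eq_exp {ν h b : ℝ} (hb : 0 ≤ b) (y : ℝ) :
    amplitude ν h b y = Complex.exp
      ((Real.log (1 + h ^ 2 * y ^ 2) : ℂ) * ((ν * Complex.I - 1) / 2) +
        (Real.log (1 + b * (h ^ 2 * y ^ 2)) : ℂ) * ((-(ν * Complex.I) - 1) / 2)) := by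
  have p1 : 0 < 1 + h ^ 2 * y ^ 2 := by positivity
  have p2 : 0 < 1 + b * (h ^ 2 * y ^ 2) := by positivity
  have hd : 0 < den h b y := mul_pos p1 p2
  have h1 : (Real.sqrt (den h b y))⁻¹ = Real.exp (-(Real.log (1 + h ^ 2 * y ^ 2) +
      Real.log (1 + b * (h ^ 2 * y ^ 2))) / 2) := by
    rw [← Real.log_mul p1.ne' p2.ne', ← den, neg_div, Real.exp_neg, ← Real.log_sqrt hd.le,
      Real.exp_log (Real.sqrt_pos.2 hd)]
  rw [amplitude, h1, Complex.ofReal_exp, ← Complex.exp_add, logPhase]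
  congr 1
  push_cast
  ring

theorem kType_mul_conj_kType {l : ℂ} (hl : l.re = 0) {a h : ℝ} (m n : ℤ) (y : ℝ) :
    kType l m ![h * y, 1] * (starRingEnd ℂ) (kType l n ![h / a ^ 2 * y, 1]) =
      Complex.exp (arctanPhase m n h a y * Complex.I) * amplitude l.im h ((a ^ 2)⁻¹ ^ 2) y := by
  have hl' : l = l.im * Complex.I := by
    apply Complex.ext <;> simp [hl]
  have p1 : 0 < 1 + (h * y) ^ 2 := by positivity
  have p2 : 0 < 1 + (h / a ^ 2 * y) ^ 2 := by positivity
  have e1 : 1 + h ^ 2 * y ^ 2 = 1 + (h * y) ^ 2 := by ring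
  have e2 : 1 + (a ^ 2)⁻¹ ^ 2 * (h ^ 2 * y ^ 2) = 1 + (h / a ^ 2 * y) ^ 2 := by ring
  rw [amplitude_eq_exp (by positivity), e1, e2, kType_line, kType_line,
    Complex.cpow_def_of_ne_zero (by exact_mod_cast p1.ne'),
    Complex.cpow_def_of_ne_zero (by exact_mod_cast p2.ne'), ← Complex.ofReal_log p1.le,
    ← Complex.ofReal_log p2.le, ← Complex.exp_add, ← Complex.exp_add, ← Complex.exp_add,
    ← Complex.exp_conj, ← Complex.exp_add, arctanPhase]
  congr 1
  generalize Real.log (1 + (h * y) ^ 2) = A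
  generalize Real.log (1 + (h / a ^ 2 * y) ^ 2) = B
  generalize Real.arctan (h * y) = C
  generalize Real.arctan (h / a ^ 2 * y) = D
  generalize hν : l.im = ν at hl' ⊢
  rw [hl']
  simp only [map_add, map_mul, map_sub, map_div₀, Complex.conj_I, Complex.conj_ofReal, map_one,
    map_intCast, map_ofNat]
  push_cast
  ring

/-- The action contributes |a^(1-λ)| = a and the substitution t = h y / a² contributes h/a². The
scale h is free here and is chosen later. -/
theorem norm_matrixCoeff_eq {l : ℂ} (hl : l.re = 0) {a h : ℝ} (ha : 0 < a) (hh : 0 < h) (m n : ℤ) :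
    ‖matrixCoeff l a ha m n‖ = Real.pi⁻¹ * (h / a) *
      ‖∫ y : ℝ, Complex.exp (arctanPhase m n h a y * Complex.I) *
        amplitude l.im h ((a ^ 2)⁻¹ ^ 2) y‖ := by
  have hc : 0 < h / a ^ 2 := by positivity
  let G : ℝ → ℂ := fun t => kType l m ![a ^ 2 * t, 1] * (starRingEnd ℂ) (kType l n ![t, 1])
  have h1 : matrixCoeff l a ha m n =
      (Real.pi : ℂ)⁻¹ * (((a⁻¹ : ℝ) : ℂ) ^ (l - 1) * ∫ t : ℝ, G t) := by
    rw [matrixCoeff, form]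
    congr 1
    rw [← integral_const_mul]
    simp only [action_diagElt_kType_line, G, mul_assoc]
  have h2 : ∫ y : ℝ, Complex.exp (arctanPhase m n h a y * Complex.I) *
      amplitude l.im h ((a ^ 2)⁻¹ ^ 2) y = ((h / a ^ 2)⁻¹ : ℝ) * ∫ t : ℝ, G t := by
    have := Measure.integral_comp_mul_left G (h / a ^ 2)
    rw [abs_of_pos (inv_pos.2 hc), Complex.real_smul] at this
    rw [← this]
    congr 1
    ext y
    simp only [G]
    rw [← kType_mul_conj_kType hl, show a ^ 2 * (h / a ^ 2 * y) = h * y by field_simp]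
  have h3 : ‖((a⁻¹ : ℝ) : ℂ) ^ (l - 1)‖ = a := by
    rw [Complex.norm_cpow_eq_rpow_re_of_pos (inv_pos.2 ha), Complex.sub_re, hl, Complex.one_re,
      zero_sub, Real.rpow_neg_one, inv_inv]
  rw [h1, h2, norm_mul, norm_mul, norm_mul, h3, norm_inv, Complex.norm_real, Complex.norm_real,
    Real.norm_of_nonneg Real.pi_pos.le, Real.norm_of_nonneg (inv_pos.2 hc).le]
  field_simp

/-- Over the common denominator the numerator is s plus a multiple of y²; the condition on h³
normalizes that multiple to -1. -/
theorem hasDerivAt_arctanPhase (m n h a y : ℝ) (ha : a ≠ 0) {s : ℝ}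
    (hs : s = m * h - n * h / a ^ 2) (hh : h ^ 3 * (n / a ^ 2 - m * (a ^ 2)⁻¹ ^ 2) = 1) :
    HasDerivAt (arctanPhase m n h a) ((s - y ^ 2) / den h ((a ^ 2)⁻¹ ^ 2) y) y := by
  have h1 : ∀ c : ℝ, HasDerivAt (fun y : ℝ => c * y) c y := fun c => by
    simpa using (hasDerivAt_id y).const_mul c
  refine (((h1 h).arctan.const_mul m).sub ((h1 (h / a ^ 2)).arctan.const_mul n)).congr_deriv ?_
  have p1 : 1 + (h * y) ^ 2 ≠ 0 := by positivity
  have p2 : 1 + (h / a ^ 2 * y) ^ 2 ≠ 0 := by positivity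
  have e : den h ((a ^ 2)⁻¹ ^ 2) y = (1 + (h * y) ^ 2) * (1 + (h / a ^ 2 * y) ^ 2) := by
    rw [den]; ring
  rw [e, eq_div_iff (mul_ne_zero p1 p2), hs]
  have : m * (1 / (1 + (h * y) ^ 2) * h) - n * (1 / (1 + (h / a ^ 2 * y) ^ 2) * (h / a ^ 2)) =
      (m * h * (1 + (h / a ^ 2 * y) ^ 2) - n * (h / a ^ 2) * (1 + (h * y) ^ 2)) /
        ((1 + (h * y) ^ 2) * (1 + (h / a ^ 2 * y) ^ 2)) := by
    field_simp
  rw [this, div_mul_cancel₀ _ (mul_ne_zero p1 p2)]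
  linear_combination (-y ^ 2) * hh

/-- `den` is at least b(1 + h²y²)², so the amplitude decays like y⁻². The constant degenerates as b
→ 0, which is harmless because only integrability is used. -/
theorem integrable_exp_mul_amplitude {ν h b : ℝ} (hh : 0 < h) (hb : 0 < b) (hb1 : b ≤ 1)
    {Φ : ℝ → ℝ} (hΦ : Continuous Φ) :
    Integrable fun y : ℝ => Complex.exp (Φ y * Complex.I) * amplitude ν h b y := by
  have hcA := continuous_amplitude (ν := ν) (h := h) hb.le
  refine Integrable.mono' ((integrable_inv_one_add_sq.comp_mul_left' hh.ne').const_mul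
    (Real.sqrt b)⁻¹) (Continuous.aestronglyMeasurable (by fun_prop)) (ae_of_all _ fun y => ?_)
  rw [norm_mul, Complex.norm_exp_ofReal_mul_I, one_mul, norm_amplitude, ← mul_inv]
  have hsb : 0 < Real.sqrt b := Real.sqrt_pos.2 hb
  refine inv_anti₀ (by positivity) (Real.le_sqrt_of_sq_le ?_)
  rw [mul_pow, Real.sq_sqrt hb.le]
  have hx : 0 ≤ h ^ 2 * y ^ 2 := by positivity
  have : b * (1 + h ^ 2 * y ^ 2) ≤ 1 + b * (h ^ 2 * y ^ 2) := by linarith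
  calc b * (1 + (h * y) ^ 2) ^ 2 = (1 + h ^ 2 * y ^ 2) * (b * (1 + h ^ 2 * y ^ 2)) := by ring
    _ ≤ den h b y := mul_le_mul_of_nonneg_left this (by positivity)

/-- Lower bound for the oscillatory integral over the line with an odd phase. -/
theorem le_norm_integral_line {ν h b c Y : ℝ} (hh : 0 < h) (hb : 0 < b) (hb1 : b ≤ 1)
    {Φ : ℝ → ℝ} (hΦ : Continuous Φ) (hodd : ∀ y, Φ (-y) = -Φ y)
    (hle : ∀ R, Y ≤ R → c ≤ ‖∫ y in (0 : ℝ)..R, (Real.cos (Φ y) : ℂ) * amplitude ν h b y‖) :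
    2 * c ≤ ‖∫ y : ℝ, Complex.exp (Φ y * Complex.I) * amplitude ν h b y‖ := by
  have hint := integrable_exp_mul_amplitude (ν := ν) hh hb hb1 hΦ
  have hlim := (intervalIntegral_tendsto_integral hint tendsto_neg_atTop_atBot
    (tendsto_id (x := atTop))).norm
  refine ge_of_tendsto hlim (eventually_atTop.2 ⟨Y, fun R hR => ?_⟩)
  simp only [id]
  have hI : ∀ u v, IntervalIntegrable
      (fun y : ℝ => Complex.exp (Φ y * Complex.I) * amplitude ν h b y) volume u v :=
    fun u v => hint.intervalIntegrable
  have heven : ∀ y, amplitude ν h b (-y) = amplitude ν h b y := fun y => by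
    simp [amplitude, den, logPhase]
  have hneg : ∫ y in (-R)..0, Complex.exp (Φ y * Complex.I) * amplitude ν h b y =
      ∫ y in (0 : ℝ)..R, Complex.exp (-(Φ y) * Complex.I) * amplitude ν h b y := by
    have := intervalIntegral.integral_comp_neg (a := 0) (b := R)
      (fun y : ℝ => Complex.exp (Φ y * Complex.I) * amplitude ν h b y)
    rw [neg_zero] at this
    rw [← this]
    refine intervalIntegral.integral_congr fun y _ => ?_
    simp only [hodd, heven, Complex.ofReal_neg]
  have hcA := continuous_amplitude (ν := ν) (h := h) hb.le
  have e : ∫ y in (-R)..R, Complex.exp (Φ y * Complex.I) * amplitude ν h b y =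
      2 * ∫ y in (0 : ℝ)..R, (Real.cos (Φ y) : ℂ) * amplitude ν h b y := by
    rw [← intervalIntegral.integral_add_adjacent_intervals (hI (-R) 0) (hI 0 R), hneg,
      ← intervalIntegral.integral_add (Continuous.intervalIntegrable (by fun_prop) _ _) (hI 0 R),
      ← intervalIntegral.integral_const_mul]
    refine intervalIntegral.integral_congr fun y _ => ?_
    simp only [Complex.ofReal_cos, Complex.cos]
    ring
  rw [e, norm_mul, Complex.norm_ofNat]
  linarith [hle R hR]

end Analysis

/-! ### Parameters in the Airy range -/

theorem rpow_neg_two_thirds_pow_three {x : ℝ} (hx : 0 < x) :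
    (x ^ (-(2 / 3) : ℝ)) ^ 3 * x ^ 2 = 1 := by
  rw [← Real.rpow_natCast, ← Real.rpow_mul hx.le, ← Real.rpow_natCast, ← Real.rpow_add hx]
  norm_num

/-- Elementary estimates for the parameters in the Airy range. Here `x` is the parameter
`n / β²` and `q = β² / a² = (1 + ε)⁻²`. -/
theorem parameter_bounds {x ε β a : ℝ} (hx : 1000 ≤ x) (hβ : 2 ≤ β) (ha : a = β * (1 + ε))
    (hε0 : 0 ≤ ε) (hε : ε ≤ x ^ (-(2 / 3) : ℝ)) :
    ε ≤ 1 / 100 ∧ 9 / 10 ≤ β ^ 2 / a ^ 2 - (a ^ 2)⁻¹ ^ 2 ∧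
      β ^ 2 / a ^ 2 - (a ^ 2)⁻¹ ^ 2 ≤ 1 ∧ 0 ≤ 1 - β ^ 2 / a ^ 2 ∧
      x ^ 2 * (1 - β ^ 2 / a ^ 2) ^ 3 ≤ 8 := by
  have hx0 : 0 < x := by linarith
  have hβ0 : 0 < β := by linarith
  have h3 : ε ^ 3 * x ^ 2 ≤ 1 := by
    rw [← rpow_neg_two_thirds_pow_three hx0]
    gcongr
  have hε1 : ε ≤ 1 / 100 := by
    by_contra hcon
    push Not at hcon
    have h4 : (1 / 100 : ℝ) ^ 3 < ε ^ 3 := pow_lt_pow_left₀ hcon (by norm_num) (by norm_num)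
    have h5 : (1000 : ℝ) ^ 2 ≤ x ^ 2 := pow_le_pow_left₀ (by norm_num) hx 2
    nlinarith
  have hq : β ^ 2 / a ^ 2 = ((1 + ε) ^ 2)⁻¹ := by
    rw [ha]
    field_simp
  have ha2 : 4 ≤ a ^ 2 := by
    rw [ha]
    nlinarith [mul_nonneg hβ0.le hε0]
  have hb : (a ^ 2)⁻¹ ^ 2 ≤ 1 / 16 := by
    have : (a ^ 2)⁻¹ ≤ 4⁻¹ := inv_anti₀ (by norm_num) ha2
    calc (a ^ 2)⁻¹ ^ 2 ≤ (4⁻¹ : ℝ) ^ 2 := pow_le_pow_left₀ (by positivity) this 2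
      _ = 1 / 16 := by norm_num
  have hb0 : 0 ≤ (a ^ 2)⁻¹ ^ 2 := by positivity
  have hq1 : ((1 + ε) ^ 2)⁻¹ ≤ 1 := inv_le_one_of_one_le₀ (by nlinarith)
  have hq2 : 1 - 2 * ε ≤ ((1 + ε) ^ 2)⁻¹ := by
    rw [← one_div, le_div_iff₀ (by positivity)]
    nlinarith [mul_nonneg hε0 (mul_nonneg hε0 hε0)]
  rw [hq]
  refine ⟨hε1, by linarith, by linarith, by linarith, ?_⟩
  have h6 : (1 - ((1 + ε) ^ 2)⁻¹) ^ 3 ≤ (2 * ε) ^ 3 :=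
    pow_le_pow_left₀ (by linarith) (by linarith) 3
  nlinarith [mul_le_mul_of_nonneg_left h6 (sq_nonneg x)]

/-- Rewrites the target in terms of m, to be matched with (h/a)². -/
theorem airy_size_eq {m n β : ℝ} (hm : 0 < m) (hβ : 0 < β) (hn : n = m * β ^ 2) :
    n ^ (-(2 / 3) : ℝ) * β ^ (-(2 / 3) : ℝ) = m ^ (-(2 / 3) : ℝ) / β ^ 2 := by
  have h : (β ^ 2) ^ (-(2 / 3) : ℝ) * β ^ (-(2 / 3) : ℝ) = (β ^ 2)⁻¹ := by
    rw [← Real.rpow_natCast β 2, ← Real.rpow_mul hβ.le, ← Real.rpow_add hβ, ← Real.rpow_neg hβ.le]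
    norm_num
  rw [hn, Real.mul_rpow hm.le (by positivity), mul_assoc, h]
  exact (div_eq_mul_inv _ _).symm

theorem rpow_neg_third_sq {x : ℝ} (hx : 0 ≤ x) :
    (x ^ (-(1 / 3) : ℝ)) ^ 2 = x ^ (-(2 / 3) : ℝ) := by
  rw [← Real.rpow_natCast, ← Real.rpow_mul hx]
  norm_num

theorem rpow_neg_third_pow_three_mul_self {x : ℝ} (hx : 0 < x) :
    (x ^ (-(1 / 3) : ℝ)) ^ 3 * x = 1 := by
  rw [← Real.rpow_natCast, ← Real.rpow_mul hx.le, ← Real.rpow_add_one hx.ne']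
  norm_num

theorem arctanPhase_neg (m n h a y : ℝ) : arctanPhase m n h a (-y) = -arctanPhase m n h a y := by
  simp only [arctanPhase, mul_neg, Real.arctan_neg]
  ring

theorem arctanPhase_zero (m n h a : ℝ) : arctanPhase m n h a 0 = 0 := by
  simp [arctanPhase]

end AiryLowerBound

/-! ### Conclusion -/

open AiryLowerBound in
theorem mainTheorem4 (l : ℂ) (hl : l.re = 0) :
    ∃ C : ℝ, 0 < C ∧ ∃ M : ℝ, ∀ (a : ℝ) (ha : 1 ≤ a) (m n : ℤ), 0 < m → 0 < n →
      ∀ β ε : ℝ, β = ((n : ℝ) / (m : ℝ)) ^ (1 / 2 : ℝ) → ε = a / β - 1 →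
        2 ≤ β → M ≤ (n : ℝ) / β ^ 2 →
        0 ≤ ε → ε ≤ ((n : ℝ) / β ^ 2) ^ (-(2 / 3) : ℝ) →
        ((n : ℝ) / β ^ 2) ^ (-(2 / 3) : ℝ) ≤ 1 / 2 →
        C * (n : ℝ) ^ (-(2 / 3) : ℝ) * β ^ (-(2 / 3) : ℝ) ≤
          ‖PrincipalSeries.matrixCoeff l a (lt_of_lt_of_le one_pos ha) m n‖ ^ 2 := by
  obtain ⟨c, hc, h₀, hh₀, Y, hmain⟩ := exists_le_norm_integral l.im
  -- The 1000 serves `parameter_bounds`; 2/h₀³ forces h ≤ h₀, since h³ = 1/(mκ) with κ ≥ 9/10.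
  refine ⟨(Real.pi⁻¹ * c) ^ 2, by positivity, max 1000 (2 / h₀ ^ 3), ?_⟩
  intro a ha m n hm hn β ε hβ hε hβ2 hM hε0 hεx _
  have hm' : (0 : ℝ) < m := by exact_mod_cast hm
  have hn' : (0 : ℝ) < n := by exact_mod_cast hn
  have ha0 : 0 < a := by linarith
  have hβ0 : 0 < β := by linarith
  have hβsq : β ^ 2 = (n : ℝ) / m := by
    rw [hβ, ← Real.sqrt_eq_rpow, Real.sq_sqrt (by positivity)]
  have hnm : (n : ℝ) = m * β ^ 2 := by rw [hβsq]; field_simp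
  have hx : (n : ℝ) / β ^ 2 = m := by rw [hnm]; field_simp
  rw [hx] at hM hεx
  have haβ : a = β * (1 + ε) := by rw [hε]; field_simp; ring
  obtain ⟨hε1, hκ1, hκ2, hr, hr3⟩ :=
    parameter_bounds ((le_max_left _ _).trans hM) hβ2 haβ hε0 hεx
  set κ : ℝ := β ^ 2 / a ^ 2 - (a ^ 2)⁻¹ ^ 2 with hκ
  have hκ0 : 0 < κ := by linarith
  have hmκ : 0 < m * κ := by positivity
  set h : ℝ := (m * κ) ^ (-(1 / 3) : ℝ) with hhdef
  have hh : 0 < h := Real.rpow_pos_of_pos hmκ _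
  have hh3 : h ^ 3 * (m * κ) = 1 := rpow_neg_third_pow_three_mul_self hmκ
  have hhle : h ≤ h₀ := by
    by_contra hcon
    push Not at hcon
    have h1 : h₀ ^ 3 < h ^ 3 := pow_lt_pow_left₀ hcon hh₀.le (by norm_num)
    have h2 : 2 ≤ (m : ℝ) * h₀ ^ 3 :=
      (div_le_iff₀ (by positivity)).1 ((le_max_right _ _).trans hM)
    nlinarith [mul_lt_mul_of_pos_right h1 hmκ, mul_le_mul_of_nonneg_right h2 hκ0.le]
  have hdiv : (n : ℝ) / a ^ 2 = m * (β ^ 2 / a ^ 2) := by rw [hnm]; ring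
  have hb0 : 0 < (a ^ 2)⁻¹ ^ 2 := by positivity
  have hb1 : (a ^ 2)⁻¹ ^ 2 ≤ 1 :=
    pow_le_one₀ (by positivity) (inv_le_one_of_one_le₀ (one_le_pow₀ ha))
  set s : ℝ := m * h - n * h / a ^ 2 with hs
  have hs' : s = m * h * (1 - β ^ 2 / a ^ 2) := by
    rw [hs, mul_div_right_comm, hdiv]
    ring
  have hs0 : 0 ≤ s := by rw [hs']; positivity
  have hs1 : s ≤ 21 / 10 := by
    -- The Airy condition bounds the right side by 8, so s³ ≤ 80/9 < 2.1³; this is where 21/10 comes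
    -- from.
    have h1 : s ^ 3 * κ = m ^ 2 * (1 - β ^ 2 / a ^ 2) ^ 3 := by
      rw [hs']
      linear_combination (m ^ 2 * (1 - β ^ 2 / a ^ 2) ^ 3) * hh3
    by_contra hcon
    push Not at hcon
    have h2 : (21 / 10 : ℝ) ^ 3 < s ^ 3 := pow_lt_pow_left₀ hcon (by norm_num) (by norm_num)
    nlinarith
  have hΦ : ∀ y, HasDerivAt (arctanPhase m n h a) ((s - y ^ 2) / den h ((a ^ 2)⁻¹ ^ 2) y) y :=
    fun y => hasDerivAt_arctanPhase m n h a y ha0.ne' hs (by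
      rw [hdiv]
      linear_combination hh3)
  have hline := le_norm_integral_line (ν := l.im) hh hb0 hb1
    (continuous_iff_continuousAt.2 fun y => (hΦ y).continuousAt)
    (arctanPhase_neg m n h a)
    (hmain h _ s hh hhle hb0.le hb1 hs0 hs1 _ (arctanPhase_zero m n h a) hΦ)
  rw [norm_matrixCoeff_eq hl ha0 hh m n, mul_assoc, airy_size_eq hm' hβ0 hnm]
  have hsize : (m : ℝ) ^ (-(2 / 3) : ℝ) ≤ h ^ 2 := by
    have h1 : h ^ 2 = (m * κ) ^ (-(2 / 3) : ℝ) := rpow_neg_third_sq hmκ.le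
    rw [h1]
    exact Real.rpow_le_rpow_of_nonpos hmκ (mul_le_of_le_one_right hm'.le hκ2) (by norm_num)
  have ha2 : a ≤ 2 * β := by
    rw [haβ]
    linarith [mul_le_mul_of_nonneg_left hε1 hβ0.le]
  -- The 2 gained by folding the line onto a half-line pays for a ≤ 2β.
  have hsize2 : (m : ℝ) ^ (-(2 / 3) : ℝ) / β ^ 2 ≤ (2 * (h / a)) ^ 2 := by
    rw [mul_pow, div_pow, ← mul_div_assoc, div_le_div_iff₀ (by positivity) (by positivity)]
    have h1 : a ^ 2 ≤ 4 * β ^ 2 :=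
      (pow_le_pow_left₀ ha0.le ha2 2).trans (le_of_eq (by ring))
    calc (m : ℝ) ^ (-(2 / 3) : ℝ) * a ^ 2 ≤ h ^ 2 * (4 * β ^ 2) :=
          mul_le_mul hsize h1 (by positivity) (by positivity)
      _ = 2 ^ 2 * h ^ 2 * β ^ 2 := by ring
  calc (Real.pi⁻¹ * c) ^ 2 * ((m : ℝ) ^ (-(2 / 3) : ℝ) / β ^ 2)
      ≤ (Real.pi⁻¹ * c) ^ 2 * (2 * (h / a)) ^ 2 :=
        mul_le_mul_of_nonneg_left hsize2 (by positivity)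
    _ = (Real.pi⁻¹ * (h / a) * (2 * c)) ^ 2 := by ring
    _ ≤ _ := by
        have hp := Real.pi_pos
        gcongr
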